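/- **Notation.** For a finite set $A\subset\mathbb N_0=\{0,1,2,\dots\}$ let $A(X)=\sum_{a\in A}X^a\in\mathbb Z[X]$ be its mask polynomial, let $\Phi_s$ be the $s$-th cyclotomic polynomial, and put $$S_A^{(2)}=\{s\in\mathbb N,\ s\ge 1:\ \Phi_s(X)\mid A(X),\ \gcd(s,\#A)=1\},\qquad A''(X)=\prod_{s\in S_A^{(2)}}\Phi_s(X),\qquad \phi_A''(\xi)=A''(e^{2\pi i\xi}).$$ The set $A$ *admits a fibered subset* if there are a nonempty $A'\subseteq A$ and a function $\sigma$ that assigns to every $s\in S_A^{(2)}$ a prime divisor $\sigma(s)$ of $s$, such that for every $s\in S_A^{(2)}$, with $p=\sigma(s)$, there is a polynomial $P\in\mathbb Z[X]$ with $$A'(X)\equiv P(X)\,\bigl(1+X^{s/p}+X^{2s/p}+\cdots+X^{(p-1)s/p}\bigr) \mod X^s-1 .$$ **Proposition.** Let $d\ge 2$, let $A_1,\dots,A_d\subset\mathbb N_0$ be finite sets with $\#A_i\ge 2$ for each $i$, and let $L$ be an integer with $L\ge\prod_{i=1}^d\#A_i$. Suppose that each $A_i$ satisfies at least one of the following conditions: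 1. $\#A_i\le 10$; 2. $\operatorname{lcm}(S_{A_i}^{(2)})$ has at most two distinct prime divisors; 3. $A_i$ admits a fibered subset. For $t=(t_1,\dots,t_{d-1})\in[0,1]^{d-1}$ put $$\phi_t''(\xi)=\phi_{A_1}''(\xi)\,\phi_{A_2}''(t_1\xi)\cdots\phi_{A_d}''(t_{d-1}\xi).$$ Then $\phi_t''$ is SLV-structured for every $t\in[0,1]^{d-1}$, with constants independent of $t$. That is, there are constants $C_1,C_2>0$, a parameter $\eta\in(0,1)$ and an integer $m_0$ such that for every $t\in[0,1]^{d-1}$ and every integer $m\ge m_0$ there is a Borel set $\Gamma\subset[0,1]$ with $$\Gamma-\Gamma\subset\Bigl\{\xi\in\mathbb R:\ \Bigl|\prod_{k=0}^{m-1}\phi_t''(L^k\xi)\Bigr|\ge L^{-C_1m}\Bigr\}\qquad\text{and}\qquad \mathcal H^1(\Gamma)\ge C_2L^{-(1-\eta)m}.$$ -/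

import Mathlib

open scoped Pointwise
open Polynomial MeasureTheory

noncomputable section

/-- The mask polynomial `A(X) = ∑_{a ∈ A} X^a ∈ ℤ[X]` of a finite set `A ⊂ ℕ₀`. -/
def maskPoly (A : Finset ℕ) : ℤ[X] := ∑ a ∈ A, X ^ a

/-- The set `S_A^{(2)}` of all `s ≥ 1` with `Φ_s(X) ∣ A(X)` and `gcd(s, #A) = 1`. -/
def accumulatingSet (A : Finset ℕ) : Set ℕ :=
  {s | 0 < s ∧ cyclotomic s ℤ ∣ maskPoly A ∧ Nat.gcd s A.card = 1}

lemma maskPoly_ne_zero {A : Finset ℕ} (hA : A.Nonempty) : maskPoly A ≠ 0 := by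
  intro h
  have h1 : (maskPoly A).eval 1 = (A.card : ℤ) := by
    simp [maskPoly, eval_finsetSum]
  rw [h, eval_zero] at h1
  exact hA.card_ne_zero (by exact_mod_cast h1.symm)

lemma accumulatingSet_finite (A : Finset ℕ) : (accumulatingSet A).Finite := by
  rcases A.eq_empty_or_nonempty with rfl | hA
  · refine (Set.finite_singleton 1).subset ?_
    rintro s ⟨-, -, hs⟩
    simpa using hs
  · refine (((((maskPoly A).map (Int.castRingHom ℂ)).roots.toFinset).finite_toSet).image
      orderOf).subset ?_
    rintro s ⟨hs, hdvd, -⟩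
    have hp : IsPrimitiveRoot (Complex.exp (2 * Real.pi * Complex.I / s)) s :=
      Complex.isPrimitiveRoot_exp s hs.ne'
    refine ⟨_, ?_, hp.eq_orderOf.symm⟩
    have hne : (maskPoly A).map (Int.castRingHom ℂ) ≠ 0 :=
      (Polynomial.map_ne_zero_iff (RingHom.injective_int _)).2 (maskPoly_ne_zero hA)
    have hd : cyclotomic s ℂ ∣ (maskPoly A).map (Int.castRingHom ℂ) := by
      have := Polynomial.map_dvd (Int.castRingHom ℂ) hdvd
      rwa [map_cyclotomic] at this
    simp only [Finset.mem_coe, Multiset.mem_toFinset, mem_roots hne]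
    exact (hp.isRoot_cyclotomic hs).dvd hd

/-- `S_A^{(2)}` as a finite set. -/
def accumulatingDivisors (A : Finset ℕ) : Finset ℕ := (accumulatingSet_finite A).toFinset

/-- The accumulating factor `A''(X) = A^{(2)}(X) = ∏_{s ∈ S_A^{(2)}} Φ_s(X)`. -/
def accumulatingFactor (A : Finset ℕ) : ℤ[X] :=
  ∏ s ∈ accumulatingDivisors A, cyclotomic s ℤ

/-- `φ_A''(ξ) = A''(e^{2πiξ})`. -/
def phiAcc (A : Finset ℕ) (ξ : ℝ) : ℂ :=
  aeval (Complex.exp (2 * Real.pi * Complex.I * ξ)) (accumulatingFactor A)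

/-- `φ_t''(ξ) = φ_{A_1}''(ξ) φ_{A_2}''(t_1 ξ) ⋯ φ_{A_d}''(t_{d-1} ξ)` with `d = n + 1`; the sets
`A_1, …, A_d` are indexed by `Fin (n + 1)`. -/
def phiAccProd {n : ℕ} (A : Fin (n + 1) → Finset ℕ) (t : Fin n → ℝ) (ξ : ℝ) : ℂ :=
  phiAcc (A 0) ξ * ∏ i : Fin n, phiAcc (A i.succ) (t i * ξ)

/-- The mask polynomial `1 + X^{s/p} + X^{2s/p} + ⋯ + X^{(p-1)s/p}` of the standard `s`-fiber in
the direction of a prime `p ∣ s`. -/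
def fiberPoly (s p : ℕ) : ℤ[X] := ∑ j ∈ Finset.range p, X ^ (j * (s / p))

/-- `A` is fibered in the `p`-direction at scale `s`:
`A(X) ≡ P(X) (1 + X^{s/p} + ⋯ + X^{(p-1)s/p})  mod  X^s - 1` for some `P ∈ ℤ[X]`. -/
def FiberedInDirection (A : Finset ℕ) (s p : ℕ) : Prop :=
  ∃ P : ℤ[X], (X ^ s - 1 : ℤ[X]) ∣ maskPoly A - P * fiberPoly s p

/-- An assignment function on `S`: to every `s ∈ S` it assigns a prime divisor of `s`. (The prime
factors of `lcm S` are recorded by the primes themselves rather than by their labels; values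
outside `S` are irrelevant.) -/
def IsAssignment (S : Finset ℕ) (σ : ℕ → ℕ) : Prop :=
  ∀ s ∈ S, (σ s).Prime ∧ σ s ∣ s

/-- `A` is `(S, σ)`-fibered. (Fiberedness at scale `s` already forces `Φ_s(X) ∣ A(X)`.) -/
def IsFibered (A S : Finset ℕ) (σ : ℕ → ℕ) : Prop :=
  ∀ s ∈ S, FiberedInDirection A s (σ s)

/-- `A` admits a fibered subset: some nonempty `A' ⊆ A` is `(S_A^{(2)}, σ)`-fibered for some
assignment function `σ` on `S_A^{(2)}`. -/
def AdmitsFiberedSubset (A : Finset ℕ) : Prop :=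
  ∃ A' : Finset ℕ, A'.Nonempty ∧ A' ⊆ A ∧
    ∃ σ : ℕ → ℕ, IsAssignment (accumulatingDivisors A) σ ∧ IsFibered A' (accumulatingDivisors A) σ

/-- `φ` is SLV-structured to the base `L` with exponent `η`, constants `C₁`, `C₂` and scale
threshold `m₀`: for every `m ≥ m₀` there is a Borel set `Γ ⊆ [0,1]` with
`|∏_{k<m} φ(L^k ξ)| ≥ L^{-C₁ m}` for all `ξ ∈ Γ - Γ`, and `H¹(Γ) ≥ C₂ L^{-(1-η)m}`. -/
def IsSLVStructuredWith (L : ℕ) (φ : ℝ → ℂ) (C₁ C₂ η : ℝ) (m₀ : ℕ) : Prop :=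
  0 < C₁ ∧ 0 < C₂ ∧ 0 < η ∧ η < 1 ∧
    ∀ m : ℕ, m₀ ≤ m → ∃ Γ : Set ℝ, MeasurableSet Γ ∧ Γ ⊆ Set.Icc 0 1 ∧
      Γ - Γ ⊆ {ξ : ℝ | (L : ℝ) ^ (-(C₁ * m)) ≤ ‖∏ k ∈ Finset.range m, φ ((L : ℝ) ^ k * ξ)‖} ∧
      ENNReal.ofReal (C₂ * (L : ℝ) ^ (-((1 - η) * m))) ≤ Measure.hausdorffMeasure 1 Γ

end

/-! The zeros of `phiAcc A` are the `ξ` for which `e^{2πiξ}` is a primitive `s`-th root of unity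
with `s` in the accumulating set. Let `p ^ (k + 1)` exactly divide such an `s`, and let `D = p ^ k *
M'`, with `M'` the part of the product of the accumulating set prime to `p`. At these zeros `D ξ` is
not an integer but `p D ξ` is, so `D ξ` has distance at least `1 / p` from the integers. Hence the
single constraint `‖D ξ‖ ≤ ρ / p`, `ρ < 1`, avoids the zeros of every `s` exactly divisible by `p ^
(k + 1)` (`not_isPrimitiveRoot_of_norm_le`), and compactness gives a lower bound
(`exists_phiAcc_lower_bound`).

Imposing such a constraint on a difference set costs only a factor `ρ / p` of measure, by averaging
over translates (`exists_set_norm_sub_le`). The cost does not depend on the dilation, whence the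
uniformity in `t`. Over `m` scales the loss is the `m`-th power of the product of all `ρ / p`, which
beats `L ^ (-(1 - η) m)` once the product of the primes used is less than `L`. It therefore suffices
that each set satisfies `HasUnitaryCover`.

For a fibered subset, the prime-power cyclotomic polynomials of the chosen directions divide its
mask polynomial, and evaluation at `1` bounds the product of the primes. In the other cases a
vanishing sum at order `q ^ (k + 1) * t` is decomposed along residue classes: sibling classes modulo
`q ^ (k + 1)` have equal sums at order `t` (`VanishesAt.class_sum_eq`). Iteration gives congruences
between class sizes (`VanishesAt.dvd_sum`). With two primes these force `q`-fold branching at each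
exponent of `q` that occurs, so `#A` is large. For `#A ≤ 10` they leave either no accumulating `s`,
or one prime `q` dividing all of them with few exponents. Strictness of the bound by `#A` comes from
coprimality to `#A` or from these direct counts. -/

/-! ### Vanishing sums and residue classes modulo prime powers -/

lemma Finset.sum_range_mul_eq {M : Type*} [AddCommMonoid M] (g : ℕ → M) (p m : ℕ) :
    ∑ v ∈ Finset.range (p * m), g v =
      ∑ w ∈ Finset.range m, ∑ i ∈ Finset.range p, g (w + i * m) := by
  induction p with
  | zero => simp
  | succ p ih =>
    rw [Nat.succ_mul, Finset.sum_range_add, ih, ← Finset.sum_add_distrib]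
    refine Finset.sum_congr rfl fun w _ => ?_
    rw [Finset.sum_range_succ, add_comm (p * m) w]

/-- If `∑ C v ω ^ v` vanishes at all primitive `p ^ (k + 1)`-th roots of unity, then `C` is
`p ^ k`-periodic. -/
lemma coeff_periodic_of_primitiveRoots {p k : ℕ} (hp : p.Prime) (c : ℕ → ℂ)
    (h : ∀ ω : ℂ, IsPrimitiveRoot ω (p ^ (k + 1)) →
      ∑ v ∈ Finset.range (p ^ (k + 1)), ω ^ v * c v = 0)
    {w i : ℕ} (hw : w < p ^ k) (hi : i < p) : c (w + i * p ^ k) = c w := by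
  set P : ℂ[X] := ∑ v ∈ Finset.range (p ^ (k + 1)), C (c v) * X ^ v with hP
  have hcoeff : ∀ v < p ^ (k + 1), P.coeff v = c v := by
    intro v hv
    rw [hP, finsetSum_coeff, Finset.sum_eq_single_of_mem v (Finset.mem_range.2 hv)]
    · rw [coeff_C_mul_X_pow, if_pos rfl]
    · intro b _ hb
      rw [coeff_C_mul_X_pow, if_neg hb.symm]
  have hpos : 0 < p ^ (k + 1) := pow_pos hp.pos _
  have hdvd : cyclotomic (p ^ (k + 1)) ℂ ∣ P := by
    rw [cyclotomic_eq_prod_X_sub_primitiveRoots (Complex.isPrimitiveRoot_exp _ hpos.ne')]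
    refine Finset.prod_dvd_of_coprime
      (fun a _ b _ hab => pairwise_coprime_X_sub_C Function.injective_id hab) fun μ hμ => ?_
    rw [dvd_iff_isRoot, IsRoot, hP, eval_finsetSum]
    rw [← h μ ((mem_primitiveRoots hpos).1 hμ)]
    refine Finset.sum_congr rfl fun v _ => ?_
    rw [eval_mul, eval_C, eval_pow, eval_X, mul_comm]
  obtain ⟨D, hD⟩ := hdvd
  have hPdeg : P.degree < (p ^ (k + 1) : ℕ) := by
    rw [hP]
    refine (degree_sum_le _ _).trans_lt ((Finset.sup_lt_iff (WithBot.bot_lt_coe _)).2 ?_)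
    intro v hv
    exact (degree_C_mul_X_pow_le _ _).trans_lt (by exact_mod_cast Finset.mem_range.1 hv)
  -- The cyclotomic factor has degree `p ^ (k + 1) - p ^ k`, which leaves degree less than `p ^ k`
  -- for the cofactor `D`.
  have hDz : ∀ j, p ^ k ≤ j → D.coeff j = 0 := by
    intro j hj
    by_cases hD0 : D = 0
    · simp [hD0]
    refine coeff_eq_zero_of_degree_lt (lt_of_lt_of_le ?_ (Nat.cast_le.2 hj))
    rw [hD, degree_mul, degree_cyclotomic, degree_eq_natDegree hD0, Nat.totient_prime_pow_succ hp]
      at hPdeg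
    rw [degree_eq_natDegree hD0]
    have h1 : p ^ k * (p - 1) + D.natDegree < p ^ (k + 1) := by exact_mod_cast hPdeg
    have h2 : p ^ k * (p - 1) + p ^ k = p ^ (k + 1) := by
      rw [pow_succ, ← Nat.mul_succ, Nat.succ_eq_add_one, Nat.sub_add_cancel hp.one_le]
    exact_mod_cast (by omega : D.natDegree < p ^ k)
  -- Since `Φ` is the sum of the `X ^ (i * p ^ k)`, the polynomial `P` consists of `p`
  -- non-overlapping shifted copies of `D`.
  have key : ∀ i < p, c (w + i * p ^ k) = D.coeff w := by
    intro i hi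
    have hlt : w + i * p ^ k < p ^ (k + 1) := by
      rw [pow_succ]; nlinarith
    rw [← hcoeff _ hlt, hD, cyclotomic_prime_pow_eq_geom_sum hp, Finset.sum_mul, finsetSum_coeff,
      Finset.sum_eq_single i]
    · rw [← pow_mul, coeff_X_pow_mul', if_pos (by nlinarith), mul_comm, Nat.add_sub_cancel]
    · intro j hj hne
      rw [← pow_mul, coeff_X_pow_mul']
      split_ifs with hle
      · refine hDz _ ?_
        rcases lt_or_gt_of_ne hne with hlt | hgt
        · have : p ^ k * (j + 1) ≤ p ^ k * i := Nat.mul_le_mul_left _ hlt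
          have e : i * p ^ k = p ^ k * i := mul_comm _ _
          have : p ^ k * (j + 1) = p ^ k * j + p ^ k := by ring
          omega
        · exfalso
          have : p ^ k * (i + 1) ≤ p ^ k * j := Nat.mul_le_mul_left _ hgt
          have : p ^ k * (i + 1) = i * p ^ k + p ^ k := by ring
          omega
      · rfl
    · intro h'; exact absurd (Finset.mem_range.2 hi) h'
  rw [key i hi, ← key 0 hp.pos]; simp

/-- The weighted sum `∑ c a X ^ a` over `A` vanishes at all primitive `t`-th roots of unity. -/
def VanishesAt (A : Finset ℕ) (c : ℕ → ℤ) (t : ℕ) : Prop :=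
  ∀ η : ℂ, IsPrimitiveRoot η t → ∑ a ∈ A, (c a : ℂ) * η ^ a = 0

lemma IsPrimitiveRoot.mul_of_coprime_orders {ω η : ℂ} {m t : ℕ} (hω : IsPrimitiveRoot ω m)
    (hη : IsPrimitiveRoot η t) (h : m.Coprime t) : IsPrimitiveRoot (ω * η) (m * t) := by
  rw [IsPrimitiveRoot.iff_orderOf] at *
  rw [(Commute.all ω η).orderOf_mul_eq_mul_orderOf_of_coprime (by rwa [hω, hη]), hω, hη]

namespace VanishesAt

variable {A : Finset ℕ} {c : ℕ → ℤ} {p k t : ℕ}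

/-- Sums over residue classes modulo `p ^ (k + 1)` that agree modulo `p ^ k` have the same value at
the primitive `t`-th roots of unity. -/
lemma class_sum_eq (h : VanishesAt A c (p ^ (k + 1) * t)) (hp : p.Prime) (hpt : p.Coprime t)
    {v v' : ℕ} (hv : v ≡ v' [MOD p ^ k]) {η : ℂ} (hη : IsPrimitiveRoot η t) :
    ∑ a ∈ A with a ≡ v [MOD p ^ (k + 1)], (c a : ℂ) * η ^ a =
      ∑ a ∈ A with a ≡ v' [MOD p ^ (k + 1)], (c a : ℂ) * η ^ a := by
  set g : ℕ → ℂ := fun v => ∑ a ∈ A with a ≡ v [MOD p ^ (k + 1)], (c a : ℂ) * η ^ a with hg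
  have hpos : 0 < p ^ (k + 1) := pow_pos hp.pos _
  have hgmod : ∀ v, g v = g (v % p ^ (k + 1)) := by
    intro v
    refine Finset.sum_congr (Finset.filter_congr fun a _ => ?_) fun _ _ => rfl
    simp [Nat.ModEq]
  have hper : ∀ v, g v = g (v % p ^ k) := by
    intro v
    rw [hgmod v]
    set r := v % p ^ (k + 1) with hr
    have hrlt : r < p ^ (k + 1) := Nat.mod_lt _ hpos
    have e1 : v % p ^ k = r % p ^ k := by
      rw [hr, Nat.mod_mod_of_dvd _ (pow_dvd_pow p (Nat.le_succ k))]
    have e2 : r = r % p ^ k + (r / p ^ k) * p ^ k := by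
      rw [mul_comm]; exact (Nat.mod_add_div _ _).symm
    rw [e1]
    conv_lhs => rw [e2]
    refine coeff_periodic_of_primitiveRoots hp g ?_ (Nat.mod_lt _ (pow_pos hp.pos _)) ?_
    · intro ω hω
      -- With `η` fixed and `ω` varying, `ω ^ a` depends only on `a` modulo `p ^ (k + 1)`, so the
      -- class sums become the coefficients of a polynomial in `ω`.
      have h0 := h (ω * η) (hω.mul_of_coprime_orders hη (Nat.Coprime.pow_left _ hpt))
      rw [← Finset.sum_fiberwise_of_maps_to (t := Finset.range (p ^ (k + 1)))
        (g := fun a => a % p ^ (k + 1)) (fun a _ => Finset.mem_range.2 (Nat.mod_lt _ hpos))] at h0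
      rw [← h0]
      refine Finset.sum_congr rfl fun v hv => ?_
      have hvv : v % p ^ (k + 1) = v := Nat.mod_eq_of_lt (Finset.mem_range.1 hv)
      simp only [hg, Nat.ModEq, hvv, Finset.mul_sum]
      refine Finset.sum_congr rfl fun a ha => ?_
      have : ω ^ a = ω ^ v := by
        rw [← (Finset.mem_filter.1 ha).2, hω.eq_orderOf, pow_mod_orderOf]
      rw [mul_pow, this]; ring
    · rw [Nat.div_lt_iff_lt_mul (pow_pos hp.pos _)]
      rwa [pow_succ, mul_comm] at hrlt
  have : v % p ^ k = v' % p ^ k := hv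
  show g v = g v'
  rw [hper v, hper v', this]

end VanishesAt

/-- If every residue class modulo `p ^ (k + 1)` above `w` modulo `p ^ k` meets `A`, then `A`
contains a transversal of these classes. -/
lemma exists_sibling_transversal {A : Finset ℕ} {p k w : ℕ} (hw : w < p ^ k)
    (h : ∀ i < p, ∃ a ∈ A, a ≡ w + i * p ^ k [MOD p ^ (k + 1)]) :
    ∃ U ⊆ A, U.card = p ∧ (∀ a ∈ U, a ≡ w [MOD p ^ k]) ∧
      ∀ a ∈ U, ∀ b ∈ U, a ≡ b [MOD p ^ (k + 1)] → a = b := by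
  choose! f hfA hf using h
  have hmod : ∀ i < p, f i ≡ w [MOD p ^ k] := fun i hi =>
    ((hf i hi).of_dvd (pow_dvd_pow p (Nat.le_succ k))).trans (by simp [Nat.ModEq])
  have hinj : ∀ i < p, ∀ j < p, f i ≡ f j [MOD p ^ (k + 1)] → i = j := by
    intro i hi j hj hij
    have h1 := ((hf i hi).symm.trans hij).trans (hf j hj)
    have hlt : ∀ i < p, w + i * p ^ k < p ^ (k + 1) := by
      intro i hi
      rw [pow_succ]; nlinarith
    have h2 := h1.eq_of_lt_of_lt (hlt i hi) (hlt j hj)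
    have : i * p ^ k = j * p ^ k := by omega
    exact Nat.eq_of_mul_eq_mul_right (by omega) this
  refine ⟨(Finset.range p).image f, ?_, ?_, ?_, ?_⟩
  · intro a ha
    obtain ⟨i, hi, rfl⟩ := Finset.mem_image.1 ha
    exact hfA i (Finset.mem_range.1 hi)
  · rw [Finset.card_image_of_injOn, Finset.card_range]
    intro i hi j hj hij
    exact hinj i (by simpa using hi) j (by simpa using hj) (by rw [hij])
  · intro a ha
    obtain ⟨i, hi, rfl⟩ := Finset.mem_image.1 ha
    exact hmod i (Finset.mem_range.1 hi)
  · intro a ha b hb hab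
    obtain ⟨i, hi, rfl⟩ := Finset.mem_image.1 ha
    obtain ⟨j, hj, rfl⟩ := Finset.mem_image.1 hb
    rw [hinj i (Finset.mem_range.1 hi) j (Finset.mem_range.1 hj) hab]

lemma sum_eq_sum_classes {M : Type*} [AddCommMonoid M] {A : Finset ℕ} {p k : ℕ} (hp : p.Prime)
    (c : ℕ → M) :
    ∑ a ∈ A, c a = ∑ w ∈ Finset.range (p ^ k), ∑ i ∈ Finset.range p,
      ∑ a ∈ A with a ≡ w + i * p ^ k [MOD p ^ (k + 1)], c a := by
  rw [← Finset.sum_range_mul_eq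
    (fun v => ∑ a ∈ A with a ≡ v [MOD p ^ (k + 1)], c a) p (p ^ k)]
  rw [← pow_succ']
  rw [← Finset.sum_fiberwise_of_maps_to (t := Finset.range (p ^ (k + 1)))
    (g := fun a => a % p ^ (k + 1))
    (fun a _ => Finset.mem_range.2 (Nat.mod_lt _ (pow_pos hp.pos _)))]
  refine Finset.sum_congr rfl fun v hv => ?_
  refine Finset.sum_congr (Finset.filter_congr fun a _ => ?_) fun _ _ => rfl
  rw [Nat.ModEq, Nat.mod_eq_of_lt (Finset.mem_range.1 hv)]

lemma exists_eq_prime_pow_succ_mul {q s : ℕ} (hq : q.Prime) (hs : 0 < s) (h : q ∣ s) :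
    ∃ k t, s = q ^ (k + 1) * t ∧ q.Coprime t ∧ 0 < t := by
  obtain ⟨e, t, ht, rfl⟩ := Nat.exists_eq_pow_mul_and_not_dvd hs.ne' q hq.ne_one
  obtain _ | k := e
  · simp at h; exact absurd h ht
  · exact ⟨k, t, rfl, (hq.coprime_iff_not_dvd).2 ht, Nat.pos_of_mul_pos_left hs⟩

/-! ### Arithmetic of the total weight of a vanishing sum -/

namespace VanishesAt

variable {A : Finset ℕ} {c : ℕ → ℤ} {p q k t : ℕ}

/-- The difference of two class sums is again a weighted sum over `A`, now at the smaller order `t`.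
This closes the inductions on the order and is the reason for integer weights. -/
lemma class_diff (h : VanishesAt A c (q ^ (k + 1) * t)) (hq : q.Prime) (hqt : q.Coprime t)
    {v v' : ℕ} (hv : v ≡ v' [MOD q ^ k]) :
    VanishesAt A (fun a => (if a ≡ v [MOD q ^ (k + 1)] then c a else 0) -
      (if a ≡ v' [MOD q ^ (k + 1)] then c a else 0)) t := by
  intro η hη
  have := h.class_sum_eq hq hqt hv hη
  rw [Finset.sum_filter, Finset.sum_filter, ← sub_eq_zero, ← Finset.sum_sub_distrib] at this
  rw [← this]
  refine Finset.sum_congr rfl fun a _ => ?_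
  push_cast
  split_ifs <;> simp

lemma of_empty_sibling (h : VanishesAt A c (q ^ (k + 1) * t)) (hq : q.Prime) (hqt : q.Coprime t)
    {v v' : ℕ} (hv : v ≡ v' [MOD q ^ k]) (he : ∀ a ∈ A, ¬ a ≡ v' [MOD q ^ (k + 1)]) :
    VanishesAt (A.filter (· ≡ v [MOD q ^ (k + 1)])) c t := by
  intro η hη
  rw [h.class_sum_eq hq hqt hv hη, Finset.filter_false_of_mem he, Finset.sum_empty]

/-- A weighted sum over `A` that vanishes at order `t`, all of whose prime factors other than `p`
exceed `#A`, has total weight divisible by `p`. -/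
theorem dvd_sum (hp : p.Prime) (ht : 0 < t)
    (hl : ∀ l, l.Prime → l ∣ t → l ≠ p → A.card < l) (h : VanishesAt A c t) :
    (p : ℤ) ∣ ∑ a ∈ A, c a := by
  induction t using Nat.strong_induction_on generalizing A c with
  | _ s ih =>
  by_cases hs1 : s = 1
  · subst hs1
    have := h 1 IsPrimitiveRoot.one
    have h0 : ∑ a ∈ A, c a = 0 := by
      simp only [one_pow, mul_one] at this
      exact_mod_cast this
    simp [h0]
  obtain ⟨q, hq, hqs⟩ := Nat.exists_prime_and_dvd hs1
  obtain ⟨k, t, rfl, hqt, ht0⟩ := exists_eq_prime_pow_succ_mul hq ht hqs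
  have hlt : t < q ^ (k + 1) * t := by
    have : 1 < q ^ (k + 1) := Nat.one_lt_pow (Nat.succ_ne_zero k) hq.one_lt
    nlinarith
  rw [sum_eq_sum_classes hq (k := k)]
  refine Finset.dvd_sum fun w hw => ?_
  by_cases hqp : q = p
  · subst hqp
    set N : ℕ → ℤ := fun v => ∑ a ∈ A with a ≡ v [MOD q ^ (k + 1)], c a with hN
    have hd : ∀ i ∈ Finset.range q, (q : ℤ) ∣ N (w + i * q ^ k) - N w := by
      intro i _
      have h1 := ih t hlt ht0 (fun l hl1 hl2 hl3 => hl l hl1 (hl2.mul_left _) hl3)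
        (h.class_diff hq hqt (v := w + i * q ^ k) (v' := w) (by simp [Nat.ModEq]))
      rwa [Finset.sum_sub_distrib, ← Finset.sum_filter, ← Finset.sum_filter] at h1
    -- The `q = p` sibling sums are congruent modulo `p`, so their total is `p` times one of them
    -- modulo `p`.
    have : ∑ i ∈ Finset.range q, N (w + i * q ^ k) =
        ∑ i ∈ Finset.range q, (N (w + i * q ^ k) - N w) + q * N w := by
      rw [Finset.sum_sub_distrib, Finset.sum_const, Finset.card_range, nsmul_eq_mul]; ring
    show (q : ℤ) ∣ ∑ i ∈ Finset.range q, N (w + i * q ^ k)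
    rw [this]
    exact dvd_add (Finset.dvd_sum hd) (dvd_mul_right _ _)
  · have hcard := hl q hq hqs hqp
    -- As `q > #A`, one of the `q` siblings is empty; hence every sibling vanishes at order `t` on
    -- its own.
    obtain ⟨j, hj, hje⟩ : ∃ j < q, ∀ a ∈ A, ¬ a ≡ w + j * q ^ k [MOD q ^ (k + 1)] := by
      by_contra! hcon
      obtain ⟨U, hU, hUc, -⟩ := exists_sibling_transversal (Finset.mem_range.1 hw) hcon
      have := Finset.card_le_card hU
      omega
    refine Finset.dvd_sum fun i _ => ?_
    refine ih t hlt ht0 (fun l hl1 hl2 hl3 => ?_) (h.of_empty_sibling hq hqt ?_ hje)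
    · exact (Finset.card_filter_le _ _).trans_lt (hl l hl1 (hl2.mul_left _) hl3)
    · simp [Nat.ModEq]

/-- No prime is exceptional here, so `dvd_sum` applies with a prime larger than the absolute value
of the total. -/
theorem sum_eq_zero (ht : 0 < t) (hl : ∀ l, l.Prime → l ∣ t → A.card < l)
    (h : VanishesAt A c t) : ∑ a ∈ A, c a = 0 := by
  obtain ⟨p, hle, hp⟩ := Nat.exists_infinite_primes ((∑ a ∈ A, c a).natAbs + 1)
  have := h.dvd_sum hp ht (fun l h1 h2 _ => hl l h1 h2)
  exact Int.eq_zero_of_dvd_of_natAbs_lt_natAbs this (by simp; omega)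

lemma dvd_class_sum_sub (h : VanishesAt A c (q ^ (k + 1) * t)) (hp : p.Prime) (hq : q.Prime)
    (hqt : q.Coprime t) (ht : 0 < t) (hl : ∀ l, l.Prime → l ∣ t → l ≠ p → A.card < l)
    {v v' : ℕ} (hv : v ≡ v' [MOD q ^ k]) :
    (p : ℤ) ∣ ∑ a ∈ A with a ≡ v [MOD q ^ (k + 1)], c a -
      ∑ a ∈ A with a ≡ v' [MOD q ^ (k + 1)], c a := by
  have h1 := (h.class_diff hq hqt hv).dvd_sum hp ht hl
  rwa [Finset.sum_sub_distrib, ← Finset.sum_filter, ← Finset.sum_filter] at h1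

lemma modEq_card_class (h : VanishesAt A 1 (q ^ (k + 1) * t)) (hp : p.Prime) (hq : q.Prime)
    (hqt : q.Coprime t) (ht : 0 < t) (hl : ∀ l, l.Prime → l ∣ t → l ≠ p → A.card < l)
    {v v' : ℕ} (hv : v ≡ v' [MOD q ^ k]) :
    (A.filter (· ≡ v [MOD q ^ (k + 1)])).card ≡
      (A.filter (· ≡ v' [MOD q ^ (k + 1)])).card [MOD p] := by
  have h1 := h.dvd_class_sum_sub hp hq hqt ht hl hv.symm
  refine (Nat.modEq_iff_dvd).2 ?_
  simpa using h1

/-- If a set vanishes at order `t`, all of whose prime factors other than `p` and `q` exceed its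
cardinality, then this cardinality is a nonnegative combination of `p` and `q`. -/
theorem card_eq_combination (hp : p.Prime) (hq : q.Prime) (ht : 0 < t)
    (hl : ∀ l, l.Prime → l ∣ t → l ≠ p → l ≠ q → A.card < l) (h : VanishesAt A 1 t) :
    ∃ i j, A.card = i * p + j * q := by
  by_cases hqt : q ∣ t
  swap
  · have h1 := h.dvd_sum hp ht fun l h1 h2 h3 => hl l h1 h2 h3 (by rintro rfl; exact hqt h2)
    have h2 : p ∣ A.card := by simpa [Int.natCast_dvd_natCast] using h1
    obtain ⟨i, hi⟩ := h2
    exact ⟨i, 0, by rw [hi]; ring⟩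
  obtain ⟨k, t, rfl, hqt', ht0⟩ := exists_eq_prime_pow_succ_mul hq ht hqt
  set N : ℕ → ℕ := fun v => (A.filter (· ≡ v [MOD q ^ (k + 1)])).card with hN
  have hcong : ∀ w i, N (w + i * q ^ k) ≡ N w [MOD p] := fun w i =>
    h.modEq_card_class hp hq hqt' ht0 (fun l h1 h2 h3 => hl l h1 (h2.mul_left _) h3
      (by rintro rfl; exact (hq.coprime_iff_not_dvd.1 hqt') h2)) (by simp [Nat.ModEq])
  have htot : A.card = ∑ w ∈ Finset.range (q ^ k), ∑ i ∈ Finset.range q, N (w + i * q ^ k) := by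
    have := sum_eq_sum_classes (A := A) (k := k) hq (1 : ℕ → ℤ)
    simp only [Pi.one_apply, Finset.sum_const, nsmul_eq_mul, mul_one] at this
    exact_mod_cast this
  -- The `q` sibling sizes share a remainder modulo `p`; the quotients contribute a multiple of `p`
  -- and the remainders a multiple of `q`.
  have hparent : ∀ w, ∃ x, ∑ i ∈ Finset.range q, N (w + i * q ^ k) = x * p + (N w % p) * q := by
    intro w
    refine ⟨∑ i ∈ Finset.range q, N (w + i * q ^ k) / p, ?_⟩
    rw [Finset.sum_mul]
    calc ∑ i ∈ Finset.range q, N (w + i * q ^ k)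
        = ∑ i ∈ Finset.range q, (N (w + i * q ^ k) / p * p + N w % p) := by
          refine Finset.sum_congr rfl fun i _ => ?_
          rw [← (hcong w i : _ % _ = _ % _)]
          exact (Nat.div_add_mod' _ _).symm
      _ = _ := by
          rw [Finset.sum_add_distrib, Finset.sum_const, Finset.card_range, smul_eq_mul,
            mul_comm q]
  choose x hx using hparent
  refine ⟨∑ w ∈ Finset.range (q ^ k), x w, ∑ w ∈ Finset.range (q ^ k), N w % p, ?_⟩
  rw [htot, Finset.sum_mul, Finset.sum_mul, ← Finset.sum_add_distrib]
  exact Finset.sum_congr rfl fun w _ => hx w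

end VanishesAt

lemma card_class_eq_sum {A : Finset ℕ} {q b : ℕ} (hq : q.Prime) (v : ℕ) :
    (A.filter (· ≡ v [MOD q ^ b])).card =
      ∑ i ∈ Finset.range q, (A.filter (· ≡ v + i * q ^ b [MOD q ^ (b + 1)])).card := by
  have h := sum_eq_sum_classes (A := A.filter (· ≡ v [MOD q ^ b])) (k := b) hq (1 : ℕ → ℕ)
  simp only [Pi.one_apply, Finset.sum_const, smul_eq_mul, mul_one] at h
  have hpos : 0 < q ^ b := pow_pos hq.pos _
  rw [h, Finset.sum_eq_single_of_mem (v % q ^ b) (Finset.mem_range.2 (Nat.mod_lt _ hpos))]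
  · have hfil : ∀ u, u ≡ v [MOD q ^ b] →
        (A.filter (· ≡ v [MOD q ^ b])).filter (· ≡ u [MOD q ^ (b + 1)]) =
          A.filter (· ≡ u [MOD q ^ (b + 1)]) := by
      intro u hu
      rw [Finset.filter_filter]
      refine Finset.filter_congr fun a _ => ⟨fun h => h.2, fun h => ⟨?_, h⟩⟩
      exact (h.of_dvd (pow_dvd_pow q (Nat.le_succ b))).trans hu
    have hcl : ∀ u, u ≡ v [MOD q ^ b] → ∀ i, u + i * q ^ b ≡ v [MOD q ^ b] := by
      intro u hu i
      exact Nat.ModEq.trans (by simp [Nat.ModEq]) hu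
    simp_rw [fun i => hfil _ (hcl _ (Nat.mod_modEq v (q ^ b)) i)]
    set d := v / q ^ b with hd
    have hv : v = v % q ^ b + d * q ^ b := (Nat.mod_add_div' _ _).symm
    -- The two families of children of `v` and of `v % q ^ b` differ by a cyclic shift of the index
    -- by `d = v / q ^ b`.
    refine Finset.sum_nbij' (fun i => (i + (q - d % q)) % q) (fun i => (i + d) % q) ?_ ?_ ?_ ?_ ?_
    · intro i _; exact Finset.mem_range.2 (Nat.mod_lt _ hq.pos)
    · intro i _; exact Finset.mem_range.2 (Nat.mod_lt _ hq.pos)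
    · intro i hi
      have hdq := Nat.mod_lt d hq.pos
      have h1 : (i + (q - d % q)) % q + d ≡ i [MOD q] := by
        calc (i + (q - d % q)) % q + d ≡ (i + (q - d % q)) + d % q [MOD q] :=
              (Nat.mod_modEq _ _).add (Nat.mod_modEq _ _).symm
          _ ≡ i [MOD q] := by
            rw [add_assoc, Nat.sub_add_cancel hdq.le]; simp [Nat.ModEq]
      exact Nat.mod_eq_of_modEq h1 (Finset.mem_range.1 hi)
    · intro i hi
      have hdq := Nat.mod_lt d hq.pos
      have h1 : (i + d) % q + (q - d % q) ≡ i [MOD q] := by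
        calc (i + d) % q + (q - d % q) ≡ (i + d % q) + (q - d % q) [MOD q] :=
              ((Nat.mod_modEq _ _).trans ((Nat.ModEq.refl i).add (Nat.mod_modEq _ _).symm)).add_right _
          _ ≡ i [MOD q] := by
            rw [add_assoc, Nat.add_sub_cancel' hdq.le]; simp [Nat.ModEq]
      exact Nat.mod_eq_of_modEq h1 (Finset.mem_range.1 hi)
    · intro i _
      have hdq := Nat.mod_lt d hq.pos
      have h1 : (i + (q - d % q)) % q + d ≡ i [MOD q] := by
        calc (i + (q - d % q)) % q + d ≡ (i + (q - d % q)) + d % q [MOD q] :=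
              (Nat.mod_modEq _ _).add (Nat.mod_modEq _ _).symm
          _ ≡ i [MOD q] := by
            rw [add_assoc, Nat.sub_add_cancel hdq.le]; simp [Nat.ModEq]
      have h2 : v + (i + (q - d % q)) % q * q ^ b ≡ v % q ^ b + i * q ^ b [MOD q ^ (b + 1)] := by
        have h3 := h1.mul_right' (q ^ b)
        rw [← pow_succ'] at h3
        have h4 := h3.add_left (v % q ^ b)
        have e : v % q ^ b + ((i + (q - d % q)) % q + d) * q ^ b =
            v + (i + (q - d % q)) % q * q ^ b := by
          conv_rhs => rw [hv]
          ring
        rwa [e] at h4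
      refine congrArg Finset.card (Finset.filter_congr fun a _ => ?_)
      exact ⟨fun h => h.trans h2.symm, fun h => h.trans h2⟩
  · intro w hw hne
    refine Finset.sum_eq_zero fun i _ => Finset.card_eq_zero.2 ?_
    refine Finset.filter_false_of_mem fun a ha hmod => hne ?_
    have h1 := (Finset.mem_filter.1 ha).2
    have h2 : a ≡ w [MOD q ^ b] :=
      (hmod.of_dvd (pow_dvd_pow q (Nat.le_succ b))).trans (by simp [Nat.ModEq])
    have h3 : w % q ^ b = v % q ^ b := h2.symm.trans h1
    rwa [Nat.mod_eq_of_lt (Finset.mem_range.1 hw)] at h3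

namespace VanishesAt

variable {A : Finset ℕ} {c : ℕ → ℤ} {p q k t : ℕ}

/-- If every family of `q` siblings had an empty member, all class sums would vanish at order `t`,
and so would their total. Thus some parent class has all its children occupied. -/
lemma exists_transversal (h : VanishesAt A 1 (q ^ (k + 1) * t)) (hq : q.Prime)
    (hqt : q.Coprime t) (hn : ¬ VanishesAt A 1 t) :
    ∃ U ⊆ A, U.card = q ∧ (∀ a ∈ U, ∀ b ∈ U, a ≡ b [MOD q ^ k]) ∧
      ∀ a ∈ U, ∀ b ∈ U, a ≡ b [MOD q ^ (k + 1)] → a = b := by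
  by_contra hcon
  refine hn fun η hη => ?_
  rw [sum_eq_sum_classes hq (k := k)]
  refine Finset.sum_eq_zero fun w hw => Finset.sum_eq_zero fun i _ => ?_
  by_cases hall : ∀ i < q, ∃ a ∈ A, a ≡ w + i * q ^ k [MOD q ^ (k + 1)]
  · obtain ⟨U, h1, h2, h3, h4⟩ := exists_sibling_transversal (Finset.mem_range.1 hw) hall
    exact absurd ⟨U, h1, h2, fun a ha b hb => (h3 a ha).trans (h3 b hb).symm, h4⟩ hcon
  · push Not at hall
    obtain ⟨j, _, hj⟩ := hall
    exact h.of_empty_sibling (v := w + i * q ^ k) hq hqt (by simp [Nat.ModEq]) hj η hη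

lemma restrict (h : VanishesAt A c t) {B : Finset ℕ} (hB : B ⊆ A)
    (hc : ∀ a ∈ A, a ∉ B → c a = 0) : VanishesAt B c t := by
  intro η hη
  rw [← h η hη]
  exact Finset.sum_subset hB fun a ha hab => by simp [hc a ha hab]

end VanishesAt

/-! ### Unitary covers from few exponents, two primes, or fibered subsets -/

/-- The exponents of `q` in the elements of the accumulating set. -/
noncomputable def accumulatingLevels (A : Finset ℕ) (q : ℕ) : Finset ℕ :=
  (accumulatingDivisors A).image fun s => s.factorization q

/-- A finite set `Q` of prime powers such that every element of the accumulating set of `A` has a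
unitary divisor in `Q`, and such that the product of the underlying primes is less than `#A`. -/
def HasUnitaryCover (A : Finset ℕ) : Prop :=
  ∃ Q : Finset ℕ, (∀ u ∈ Q, ∃ p k, p.Prime ∧ u = p ^ (k + 1)) ∧
    (∀ s ∈ accumulatingDivisors A, ∃ u ∈ Q, ∃ t, s = u * t ∧ u.Coprime t) ∧
    ∏ u ∈ Q, u.minFac < A.card

lemma mem_accumulatingDivisors {A : Finset ℕ} {s : ℕ} : s ∈ accumulatingDivisors A ↔
    0 < s ∧ cyclotomic s ℤ ∣ maskPoly A ∧ Nat.gcd s A.card = 1 := by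
  simp [accumulatingDivisors, accumulatingSet]

lemma vanishesAt_of_mem {A : Finset ℕ} {s : ℕ} (h : s ∈ accumulatingDivisors A) :
    VanishesAt A 1 s := by
  intro η hη
  obtain ⟨hs, ⟨P, hP⟩, -⟩ := mem_accumulatingDivisors.1 h
  have h1 : aeval η (maskPoly A) = 0 := by
    rw [hP, map_mul, aeval_def, ← eval_map, algebraMap_int_eq, map_cyclotomic]
    rw [(hη.isRoot_cyclotomic hs).eq_zero, zero_mul]
  simpa [maskPoly] using h1

lemma coprime_card_of_mem {A : Finset ℕ} {s : ℕ} (h : s ∈ accumulatingDivisors A) :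
    s.Coprime A.card := (mem_accumulatingDivisors.1 h).2.2

lemma pos_of_mem_accumulatingDivisors {A : Finset ℕ} {s : ℕ} (h : s ∈ accumulatingDivisors A) :
    0 < s := (mem_accumulatingDivisors.1 h).1

lemma hasUnitaryCover_of_empty {A : Finset ℕ} (h2 : 2 ≤ A.card)
    (h : ∀ s, s ∉ accumulatingDivisors A) : HasUnitaryCover A :=
  ⟨∅, by simp, fun s hs => absurd hs (h s), by rw [Finset.prod_empty]; omega⟩

lemma exists_of_mem_accumulatingLevels {A : Finset ℕ} {q b : ℕ} (hq : q.Prime)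
    (hdvd : ∀ s ∈ accumulatingDivisors A, q ∣ s) (hb : b ∈ accumulatingLevels A q) :
    ∃ k t, b = k + 1 ∧ 0 < t ∧ q.Coprime t ∧ q ^ (k + 1) * t ∈ accumulatingDivisors A := by
  obtain ⟨s, hs, rfl⟩ := Finset.mem_image.1 hb
  obtain ⟨k, t, rfl, hqt, ht⟩ :=
    exists_eq_prime_pow_succ_mul hq (pos_of_mem_accumulatingDivisors hs) (hdvd s hs)
  refine ⟨k, t, ?_, ht, hqt, hs⟩
  rw [Nat.factorization_mul (pow_pos hq.pos _).ne' ht.ne', hq.factorization_pow]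
  simp [Nat.factorization_eq_zero_of_not_dvd (hq.coprime_iff_not_dvd.1 hqt)]

/-- A single prime dividing all elements of the accumulating set gives a unitary cover when it
occurs with few exponents. -/
lemma hasUnitaryCover_of_prime {A : Finset ℕ} {q : ℕ} (hq : q.Prime)
    (hdvd : ∀ s ∈ accumulatingDivisors A, q ∣ s)
    (hlt : q ^ (accumulatingLevels A q).card < A.card) : HasUnitaryCover A := by
  refine ⟨(accumulatingLevels A q).image (q ^ ·), ?_, ?_, ?_⟩
  · intro u hu
    obtain ⟨b, hb, rfl⟩ := Finset.mem_image.1 hu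
    obtain ⟨k, t, rfl, -⟩ := exists_of_mem_accumulatingLevels hq hdvd hb
    exact ⟨q, k, hq, rfl⟩
  · intro s hs
    refine ⟨q ^ s.factorization q, Finset.mem_image_of_mem _ (Finset.mem_image_of_mem _ hs),
      s / q ^ s.factorization q, (Nat.ordProj_mul_ordCompl_eq_self s q).symm, ?_⟩
    exact Nat.Coprime.pow_left _ (Nat.coprime_ordCompl hq (pos_of_mem_accumulatingDivisors hs).ne')
  · refine lt_of_le_of_lt ?_ hlt
    rw [Finset.prod_congr rfl (g := fun _ => q), Finset.prod_const]
    · exact Nat.pow_le_pow_right hq.pos Finset.card_image_le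
    · intro u hu
      obtain ⟨b, hb, rfl⟩ := Finset.mem_image.1 hu
      obtain ⟨k, t, rfl, -⟩ := exists_of_mem_accumulatingLevels hq hdvd hb
      exact hq.pow_minFac (Nat.succ_ne_zero k)

/-- If `A` vanishes at orders `q ^ b * t`, `b ∈ K`, where `t` is a power of a prime `p` not dividing
`#A`, then `#A ≥ q ^ #K`. -/
theorem pow_card_le_card_of_vanishesAt {A K : Finset ℕ} {p q : ℕ} (hp : p.Prime) (hq : q.Prime)
    (hK : ∀ b ∈ K, ∃ k t, b = k + 1 ∧ 0 < t ∧ q.Coprime t ∧ (∀ l, l.Prime → l ∣ t → l = p) ∧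
      VanishesAt A 1 (q ^ (k + 1) * t))
    (hpA : ¬ p ∣ A.card) : q ^ K.card ≤ A.card := by
  set N : ℕ → ℕ → ℕ := fun b v => (A.filter (· ≡ v [MOD q ^ b])).card with hN
  -- Induction down from the largest exponent in `K`: a class modulo `q ^ b` whose size is prime to
  -- `p` has at least one factor `q` for each exponent in `K` above `b`.
  have claim : ∀ d b v, b + d = K.sup id → ¬ p ∣ N b v → q ^ (K.filter (b < ·)).card ≤ N b v := by
    intro d
    induction d with
    | zero =>
      intro b v hb hv
      have : K.filter (b < ·) = ∅ := by
        refine Finset.filter_false_of_mem fun x hx => ?_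
        have : x ≤ K.sup id := Finset.le_sup (f := id) hx
        omega
      rw [this, Finset.card_empty, pow_zero]
      exact Nat.pos_of_ne_zero fun h0 => hv (h0 ▸ dvd_zero p)
    | succ d ih =>
      intro b v hb hv
      have hsum : N b v = ∑ i ∈ Finset.range q, N (b + 1) (v + i * q ^ b) := card_class_eq_sum hq v
      -- At an exponent in `K` all children are congruent modulo `p`, hence all prime to `p`, and
      -- the bound gains a factor `q`. Otherwise one child prime to `p` is enough.
      by_cases hbK : b + 1 ∈ K
      · obtain ⟨k, t, hk, ht, hqt, hl, hvan⟩ := hK _ hbK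
        obtain rfl : b = k := by omega
        have hcong : ∀ i j, N (b + 1) (v + i * q ^ b) ≡ N (b + 1) (v + j * q ^ b) [MOD p] :=
          fun i j => hvan.modEq_card_class hp hq hqt ht
            (fun l h1 h2 h3 => absurd (hl l h1 h2) h3) (by simp [Nat.ModEq])
        have hnd : ∀ i, ¬ p ∣ N (b + 1) (v + i * q ^ b) := by
          intro i hi
          refine hv (hsum ▸ Finset.dvd_sum fun j _ => ?_)
          exact ((hcong i j).dvd_iff dvd_rfl).1 hi
        have hfil : K.filter (b < ·) = insert (b + 1) (K.filter (b + 1 < ·)) := by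
          ext x
          simp only [Finset.mem_filter, Finset.mem_insert]
          constructor
          · rintro ⟨h1, h2⟩
            rcases Nat.lt_or_ge (b + 1) x with h | h
            · exact Or.inr ⟨h1, h⟩
            · exact Or.inl (by omega)
          · rintro (rfl | ⟨h1, h2⟩)
            · exact ⟨hbK, by omega⟩
            · exact ⟨h1, by omega⟩
        rw [hfil, Finset.card_insert_of_notMem (by simp), pow_succ', hsum]
        calc q * q ^ (K.filter (b + 1 < ·)).card
            = ∑ i ∈ Finset.range q, q ^ (K.filter (b + 1 < ·)).card := by simp
          _ ≤ _ := Finset.sum_le_sum fun i _ => ih _ _ (by omega) (hnd i)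
      · obtain ⟨i, hi, hnd⟩ : ∃ i ∈ Finset.range q, ¬ p ∣ N (b + 1) (v + i * q ^ b) := by
          by_contra! hcon
          exact hv (hsum ▸ Finset.dvd_sum hcon)
        have hfil : K.filter (b < ·) = K.filter (b + 1 < ·) := by
          refine Finset.filter_congr fun x hx => ⟨fun h => ?_, fun h => by omega⟩
          rcases Nat.lt_or_ge (b + 1) x with h' | h'
          · exact h'
          · exact absurd ((by omega : x = b + 1) ▸ hx) hbK
        rw [hfil, hsum]
        exact (ih _ _ (by omega) hnd).trans
          (Finset.single_le_sum (f := fun i => N (b + 1) (v + i * q ^ b)) (fun _ _ => Nat.zero_le _) hi)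
  have h0 : N 0 0 = A.card := by simp [hN, Nat.modEq_one]
  have := claim (K.sup id) 0 0 (by simp) (by rwa [h0])
  rw [h0] at this
  refine le_trans (le_of_eq ?_) this
  rw [Finset.filter_true_of_mem]
  intro b hb
  obtain ⟨k, t, rfl, -⟩ := hK b hb
  omega

/-- If the accumulating set involves at most two primes, then there is a unitary cover. -/
theorem hasUnitaryCover_of_two_primes {A : Finset ℕ} (h2 : 2 ≤ A.card)
    (h : ((accumulatingDivisors A).lcm id).primeFactors.card ≤ 2) : HasUnitaryCover A := by
  by_cases hemp : accumulatingDivisors A = ∅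
  · exact hasUnitaryCover_of_empty h2 fun s => by simp [hemp]
  have hne : (accumulatingDivisors A).lcm id ≠ 0 := by
    rw [Ne, Finset.lcm_eq_zero_iff]
    rintro ⟨s, hs, h0⟩
    exact (pos_of_mem_accumulatingDivisors hs).ne' h0
  have hsub : ∀ s ∈ accumulatingDivisors A,
      s.primeFactors ⊆ ((accumulatingDivisors A).lcm id).primeFactors := fun s hs =>
    Nat.primeFactors_mono (Finset.dvd_lcm (f := id) hs) hne
  -- If `s` had a single prime `p`, then `p` would divide `#A`, against coprimality; for `s = 1` the
  -- vanishing reads `#A = 0`. So every `s` involves both primes.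
  have hcard : ∀ s ∈ accumulatingDivisors A, 2 ≤ s.primeFactors.card := by
    intro s hs
    by_contra! hlt
    have hs0 := pos_of_mem_accumulatingDivisors hs
    obtain ⟨p, hp, hps, hall⟩ : ∃ p, p.Prime ∧ (∀ l, l.Prime → l ∣ s → l = p) ∧
        (p ∣ s ∨ s = 1) := by
      rcases Nat.le_one_iff_eq_zero_or_eq_one.1 (Nat.lt_succ_iff.1 hlt) with h0 | h1
      · have hs1 : s = 1 := by
          rcases Nat.primeFactors_eq_empty.1 (Finset.card_eq_zero.1 h0) with h | h
          · omega
          · exact h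
        -- The prime `2` is a dummy: no prime divides `s = 1`.
        refine ⟨2, Nat.prime_two, fun l hl hls => ?_, Or.inr hs1⟩
        rw [hs1] at hls
        exact absurd (Nat.dvd_one.1 hls) hl.ne_one
      · obtain ⟨p, hp⟩ := Finset.card_eq_one.1 h1
        have hmem : p ∈ s.primeFactors := by simp [hp]
        refine ⟨p, Nat.prime_of_mem_primeFactors hmem, fun l hl hls => ?_,
          Or.inl (Nat.dvd_of_mem_primeFactors hmem)⟩
        have : l ∈ s.primeFactors := Nat.mem_primeFactors.2 ⟨hl, hls, hs0.ne'⟩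
        simpa [hp] using this
    rcases hall with hdvd | rfl
    · have h3 := (vanishesAt_of_mem hs).dvd_sum hp hs0 fun l h1 h2 h3 => absurd (hps l h1 h2) h3
      have h4 : p ∣ A.card := by simpa [Int.natCast_dvd_natCast] using h3
      exact hp.one_lt.ne' (Nat.dvd_one.1
        ((coprime_card_of_mem hs : Nat.gcd _ _ = 1) ▸ Nat.dvd_gcd hdvd h4))
    · have := (vanishesAt_of_mem hs).sum_eq_zero one_pos
        fun l hl h1 => absurd (Nat.dvd_one.1 h1) hl.ne_one
      simp at this
      simp [this] at h2
  obtain ⟨s₀, hs₀⟩ := Finset.nonempty_iff_ne_empty.2 hemp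
  have heq : ∀ s ∈ accumulatingDivisors A,
      s.primeFactors = ((accumulatingDivisors A).lcm id).primeFactors := fun s hs =>
    Finset.eq_of_subset_of_card_le (hsub s hs) (h.trans (hcard s hs))
  obtain ⟨p, q, hpq, hPQ⟩ := Finset.card_eq_two.1
    (le_antisymm (heq s₀ hs₀ ▸ h) (hcard s₀ hs₀))
  have hmem : ∀ s ∈ accumulatingDivisors A, ∀ l, l ∈ s.primeFactors ↔ l = p ∨ l = q := by
    intro s hs l
    rw [heq s hs, ← heq s₀ hs₀, hPQ]; simp
  have hp : p.Prime := Nat.prime_of_mem_primeFactors ((hmem s₀ hs₀ p).2 (Or.inl rfl))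
  have hq : q.Prime := Nat.prime_of_mem_primeFactors ((hmem s₀ hs₀ q).2 (Or.inr rfl))
  have hnd : ∀ l, l.Prime → l ∣ s₀ → ¬ l ∣ A.card := by
    intro l hl h1 h2
    exact hl.one_lt.ne' (Nat.dvd_one.1
        ((coprime_card_of_mem hs₀ : Nat.gcd _ _ = 1) ▸ Nat.dvd_gcd h1 h2))
  have hdvd : ∀ s ∈ accumulatingDivisors A, q ∣ s := fun s hs =>
    Nat.dvd_of_mem_primeFactors ((hmem s hs q).2 (Or.inr rfl))
  refine hasUnitaryCover_of_prime hq hdvd ?_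
  -- Equality would make `q` divide `#A`.
  refine lt_of_le_of_ne (pow_card_le_card_of_vanishesAt hp hq ?_ (hnd p hp
    (Nat.dvd_of_mem_primeFactors ((hmem s₀ hs₀ p).2 (Or.inl rfl))))) ?_
  · intro b hb
    obtain ⟨k, t, rfl, ht, hqt, hs⟩ := exists_of_mem_accumulatingLevels hq hdvd hb
    refine ⟨k, t, rfl, ht, hqt, fun l hl hlt => ?_, vanishesAt_of_mem hs⟩
    rcases (hmem _ hs l).1 (Nat.mem_primeFactors.2 ⟨hl, hlt.mul_left _,
      (pos_of_mem_accumulatingDivisors hs).ne'⟩) with h | rfl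
    · exact h
    · exact absurd hlt (hq.coprime_iff_not_dvd.1 hqt)
  · intro heq'
    have hpos : (accumulatingLevels A q).card ≠ 0 :=
      (Finset.card_pos.2 ⟨_, Finset.mem_image_of_mem _ hs₀⟩).ne'
    exact hnd q hq (hdvd s₀ hs₀) (heq' ▸ dvd_pow_self q hpos)

/-- A fibered subset yields a unitary cover. -/
theorem hasUnitaryCover_of_admitsFiberedSubset {A : Finset ℕ} (h2 : 2 ≤ A.card)
    (h : AdmitsFiberedSubset A) : HasUnitaryCover A := by
  obtain ⟨A', hA', hsub, σ, hσ, hfib⟩ := h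
  set Q := (accumulatingDivisors A).image fun s => σ s ^ s.factorization (σ s) with hQ
  have hexp : ∀ s ∈ accumulatingDivisors A, ∃ k t, s = σ s ^ (k + 1) * t ∧
      (σ s).Coprime t ∧ 0 < t ∧ s.factorization (σ s) = k + 1 := by
    intro s hs
    obtain ⟨hp, hps⟩ := hσ s hs
    obtain ⟨k, t, hst, hqt, ht⟩ :=
      exists_eq_prime_pow_succ_mul hp (pos_of_mem_accumulatingDivisors hs) hps
    refine ⟨k, t, hst, hqt, ht, ?_⟩
    generalize σ s = p at *
    rw [hst, Nat.factorization_mul (pow_pos hp.pos _).ne' ht.ne', hp.factorization_pow]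
    simp [Nat.factorization_eq_zero_of_not_dvd (hp.coprime_iff_not_dvd.1 hqt)]
  have hQp : ∀ u ∈ Q, ∃ p k, p.Prime ∧ u = p ^ (k + 1) := by
    intro u hu
    obtain ⟨s, hs, rfl⟩ := Finset.mem_image.1 hu
    obtain ⟨k, t, -, -, -, he⟩ := hexp s hs
    exact ⟨σ s, k, (hσ s hs).1, by rw [he]⟩
  -- For `ζ` of order `p ^ (k + 1)`, the number `ζ ^ (s / p)` is a `p`-th root of unity other than
  -- `1`, so the fiber polynomial vanishes at `ζ`, and so does `A'`.
  have hQd : ∀ u ∈ Q, cyclotomic u ℤ ∣ maskPoly A' := by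
    intro u hu
    obtain ⟨s, hs, rfl⟩ := Finset.mem_image.1 hu
    obtain ⟨k, t, hst, hpt, ht, he⟩ := hexp s hs
    have hp := (hσ s hs).1
    obtain ⟨P, hP⟩ := hfib s hs
    rw [he]
    generalize σ s = p at *
    have hpos : 0 < p ^ (k + 1) := pow_pos hp.pos _
    have hζ := Complex.isPrimitiveRoot_exp (p ^ (k + 1)) hpos.ne'
    set ζ := Complex.exp (2 * Real.pi * Complex.I / (p ^ (k + 1) : ℕ))
    have hζs : ζ ^ s = 1 := by rw [hst, pow_mul, hζ.pow_eq_one, one_pow]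
    have hsp : s / p * p = s := Nat.div_mul_cancel ⟨p ^ k * t, by rw [hst]; ring⟩
    have hω : ζ ^ (s / p) ≠ 1 := by
      rw [Ne, hζ.pow_eq_one_iff_dvd]
      intro hd
      have h1 : p ^ (k + 1) * p ∣ p ^ (k + 1) * t := by
        rw [← hst, ← hsp]
        exact Nat.mul_dvd_mul_right hd p
      exact hp.coprime_iff_not_dvd.1 hpt (Nat.dvd_of_mul_dvd_mul_left hpos h1)
    have hF : aeval ζ (fiberPoly s p) = 0 := by
      have h1 : aeval ζ (fiberPoly s p) = ∑ j ∈ Finset.range p, (ζ ^ (s / p)) ^ j := by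
        simp [fiberPoly, pow_mul']
      have h2 := geom_sum_mul (ζ ^ (s / p)) p
      rw [← pow_mul, hsp, hζs, sub_self] at h2
      rw [h1]
      exact (mul_eq_zero.1 h2).resolve_right (sub_ne_zero.2 hω)
    have hroot : aeval ζ (maskPoly A') = 0 := by
      obtain ⟨R, hR⟩ := hP
      have h1 := congrArg (aeval ζ) hR
      rw [map_sub, map_mul, map_mul, hF, mul_zero, sub_zero] at h1
      rw [h1]
      simp [hζs]
    rw [cyclotomic_eq_minpoly hζ hpos]
    exact minpoly.isIntegrallyClosed_dvd (hζ.isIntegral hpos) hroot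
  have hprod : (∏ u ∈ Q, cyclotomic u ℤ) ∣ maskPoly A' := by
    refine Finset.prod_dvd_of_isRelPrime (fun u hu v hv huv => ?_) hQd
    obtain ⟨p, k, hp, rfl⟩ := hQp u hu
    obtain ⟨p', k', hp', rfl⟩ := hQp v hv
    have hi := cyclotomic.irreducible (pow_pos hp.pos (k + 1))
    have hi' := cyclotomic.irreducible (pow_pos hp'.pos (k' + 1))
    refine hi.isRelPrime_iff_not_dvd.2 fun hd => huv ?_
    exact cyclotomic_injective (R := ℤ) (eq_of_monic_of_associated (cyclotomic.monic _ _)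
      (cyclotomic.monic _ _) (hi.associated_of_dvd hi' hd))
  -- Evaluation at `1`, where `Φ_{p ^ (k + 1)}` takes the value `p`.
  have hdvd : ((∏ u ∈ Q, u.minFac : ℕ) : ℤ) ∣ (A'.card : ℤ) := by
    have := map_dvd (evalRingHom (1 : ℤ)) hprod
    rw [map_prod] at this
    have h1 : evalRingHom (1 : ℤ) (maskPoly A') = A'.card := by
      simp [maskPoly]
    rw [h1] at this
    refine dvd_trans (dvd_of_eq ?_) this
    rw [Nat.cast_prod]
    refine Finset.prod_congr rfl fun u hu => ?_
    obtain ⟨p, k, hp, rfl⟩ := hQp u hu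
    have := Fact.mk hp
    rw [coe_evalRingHom, eval_one_cyclotomic_prime_pow, hp.pow_minFac (Nat.succ_ne_zero k)]
  refine ⟨Q, hQp, ?_, ?_⟩
  · intro s hs
    obtain ⟨k, t, hst, hpt, -, he⟩ := hexp s hs
    exact ⟨_, Finset.mem_image_of_mem _ hs, t, by rw [he]; exact hst, hpt.pow_left _⟩
  · have hle : ∏ u ∈ Q, u.minFac ≤ A.card :=
      (Nat.le_of_dvd hA'.card_pos (Int.natCast_dvd_natCast.1 hdvd)).trans
        (Finset.card_le_card hsub)
    refine lt_of_le_of_ne hle fun heq => ?_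
    have hQne : Q.Nonempty := by
      rw [Finset.nonempty_iff_ne_empty]
      intro h0
      rw [h0, Finset.prod_empty] at heq
      omega
    obtain ⟨u, hu⟩ := hQne
    obtain ⟨s, hs, rfl⟩ := Finset.mem_image.1 hu
    obtain ⟨k, t, -, -, -, he⟩ := hexp s hs
    have hp := (hσ s hs).1
    have h1 : σ s ∣ A.card := by
      rw [← heq]
      refine dvd_trans (dvd_of_eq ?_) (Finset.dvd_prod_of_mem Nat.minFac hu)
      rw [he, hp.pow_minFac (Nat.succ_ne_zero k)]
    exact hp.one_lt.ne' (Nat.dvd_one.1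
        ((coprime_card_of_mem hs : Nat.gcd _ _ = 1) ▸ Nat.dvd_gcd (hσ s hs).2 h1))

/-! ### Dyadic classes with few elements -/

lemma exists_digit {a b m k : ℕ} (hm : 0 < m) (h : a ≡ b [MOD m ^ k]) :
    ∃ i < m, a ≡ b % m ^ k + i * m ^ k [MOD m ^ (k + 1)] := by
  refine ⟨a / m ^ k % m, Nat.mod_lt _ hm, ?_⟩
  have h1 : a = b % m ^ k + a / m ^ k * m ^ k := by
    rw [← (h : a % _ = b % _)]; exact (Nat.mod_add_div' _ _).symm
  have h2 : a / m ^ k * m ^ k ≡ a / m ^ k % m * m ^ k [MOD m ^ (k + 1)] := by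
    rw [pow_succ']
    exact (Nat.mod_modEq _ _).symm.mul_right' _
  conv_lhs => rw [h1]
  exact h2.add_left _

lemma not_modEq_add_mul_pow {p k a i : ℕ} (hi : 0 < i) (hip : i < p) :
    ¬ a + i * p ^ k ≡ a [MOD p ^ (k + 1)] := by
  intro h
  have h1 : p ^ (k + 1) ∣ i * p ^ k := (Nat.modEq_zero_iff_dvd).1
    (Nat.ModEq.add_left_cancel' a (by simpa using h))
  rw [pow_succ'] at h1
  have := Nat.le_of_dvd hi (Nat.dvd_of_mul_dvd_mul_right (pow_pos (by omega) k) h1)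
  omega

lemma five_le_prime {l : ℕ} (hl : l.Prime) (h2 : l ≠ 2) (h3 : l ≠ 3) : 5 ≤ l := by
  have := hl.two_le
  by_contra! hlt
  obtain rfl : l = 4 := by omega
  exact absurd hl (by norm_num)

lemma eleven_le_prime {l : ℕ} (hl : l.Prime) (h2 : l ≠ 2) (h3 : l ≠ 3) (h5 : l ≠ 5)
    (h7 : l ≠ 7) : 11 ≤ l := by
  by_contra! hlt
  have := hl.two_le
  interval_cases l <;> first | omega | exact absurd hl (by norm_num)

lemma ne_of_coprime_of_dvd {p l t : ℕ} (hp : p.Prime) (h : p.Coprime t) (hlt : l ∣ t) : l ≠ p := by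
  rintro rfl
  exact hp.coprime_iff_not_dvd.1 h hlt

/-- The number of elements of `A` congruent to `x` modulo `2 ^ k`. -/
def dyadicCard (A : Finset ℕ) (k x : ℕ) : ℕ := (A.filter (· ≡ x [MOD 2 ^ k])).card

section dyadic

variable {A : Finset ℕ} {k t x y : ℕ}

lemma dyadicCard_pos (hx : x ∈ A) : 1 ≤ dyadicCard A k x :=
  Finset.card_pos.2 ⟨x, Finset.mem_filter.2 ⟨hx, Nat.ModEq.refl x⟩⟩

lemma dyadicCard_anti {k' : ℕ} (h : k ≤ k') : dyadicCard A k' x ≤ dyadicCard A k x :=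
  Finset.card_le_card (Finset.monotone_filter_right _
    fun _ _ ha => Nat.ModEq.of_dvd (pow_dvd_pow 2 h) ha)

lemma dyadicCard_add_le (h : ¬ x ≡ y [MOD 2 ^ k]) :
    dyadicCard A k x + dyadicCard A k y ≤ A.card := by
  rw [dyadicCard, dyadicCard, ← Finset.card_union_of_disjoint]
  · exact Finset.card_le_card
      (Finset.union_subset (Finset.filter_subset _ _) (Finset.filter_subset _ _))
  · rw [Finset.disjoint_filter]
    exact fun a _ h1 h2 => h (h1.symm.trans h2)

lemma dyadicCard_succ_add :
    dyadicCard A k x = dyadicCard A (k + 1) x + dyadicCard A (k + 1) (x + 2 ^ k) := by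
  have := card_class_eq_sum (A := A) (b := k) Nat.prime_two x
  simpa [dyadicCard, Finset.sum_range_succ] using this

/-- The signed sum over the two halves of a dyadic class vanishes at the odd part. -/
lemma VanishesAt.dyadic_class (h : VanishesAt A 1 (2 ^ (k + 1) * t)) (ht : Nat.Coprime 2 t)
    (x : ℕ) : VanishesAt (A.filter (· ≡ x [MOD 2 ^ k]))
      (fun a => (if a ≡ x [MOD 2 ^ (k + 1)] then 1 else 0) -
        (if a ≡ x + 2 ^ k [MOD 2 ^ (k + 1)] then 1 else 0)) t := by
  refine (h.class_diff Nat.prime_two ht (v := x) (v' := x + 2 ^ k) (by simp [Nat.ModEq])).restrict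
    (Finset.filter_subset _ _) fun a ha hna => ?_
  have h0 : ¬ a ≡ x [MOD 2 ^ k] := fun h' => hna (Finset.mem_filter.2 ⟨ha, h'⟩)
  rw [if_neg, if_neg, sub_zero]
  · intro h'
    exact h0 ((h'.of_dvd (pow_dvd_pow 2 (Nat.le_succ k))).trans (by simp [Nat.ModEq]))
  · intro h'
    exact h0 (h'.of_dvd (pow_dvd_pow 2 (Nat.le_succ k)))

lemma dyadic_sum_eq :
    ∑ a ∈ A.filter (· ≡ x [MOD 2 ^ k]), ((if a ≡ x [MOD 2 ^ (k + 1)] then 1 else 0) -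
        (if a ≡ x + 2 ^ k [MOD 2 ^ (k + 1)] then 1 else 0) : ℤ) =
      dyadicCard A (k + 1) x - dyadicCard A (k + 1) (x + 2 ^ k) := by
  have hfil : ∀ u, u ≡ x [MOD 2 ^ k] →
      (A.filter (· ≡ x [MOD 2 ^ k])).filter (· ≡ u [MOD 2 ^ (k + 1)]) =
        A.filter (· ≡ u [MOD 2 ^ (k + 1)]) := by
    intro u hu
    rw [Finset.filter_filter]
    exact Finset.filter_congr fun a _ => ⟨fun h => h.2, fun h =>
      ⟨(h.of_dvd (pow_dvd_pow 2 (Nat.le_succ k))).trans hu, h⟩⟩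
  rw [Finset.sum_sub_distrib, ← Finset.sum_filter, ← Finset.sum_filter, hfil x rfl,
    hfil _ (by simp [Nat.ModEq])]
  simp [dyadicCard]

/-- A dyadic class with at most four elements at a vanishing level has sizes `2 = 1 + 1`,
`3 = 3 + 0` or `4 = 2 + 2`. -/
lemma VanishesAt.dyadicCard_small (h : VanishesAt A 1 (2 ^ (k + 1) * t)) (ht : Nat.Coprime 2 t)
    (ht0 : 0 < t) (hx : x ∈ A) (h4 : dyadicCard A k x ≤ 4) :
    dyadicCard A k x = 2 ∧ dyadicCard A (k + 1) x = 1 ∨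
      dyadicCard A k x = 3 ∧ dyadicCard A (k + 1) x = 3 ∨
      dyadicCard A k x = 4 ∧ dyadicCard A (k + 1) x = 2 := by
  -- The prime factors of `t` other than `3` are at least `5`, so the two halves differ by a
  -- multiple of `3`; the half containing `x` is nonempty.
  have h1 := (h.dyadic_class ht x).dvd_sum Nat.prime_three ht0 fun l hl hlt h3 => by
    refine lt_of_le_of_lt h4 ?_
    exact five_le_prime hl (ne_of_coprime_of_dvd Nat.prime_two ht hlt) h3
  rw [dyadic_sum_eq] at h1
  have h2 := dyadicCard_succ_add (A := A) (k := k) (x := x)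
  have h3 := dyadicCard_pos (k := k + 1) hx
  generalize dyadicCard A k x = n at *
  generalize dyadicCard A (k + 1) x = n0 at *
  generalize dyadicCard A (k + 1) (x + 2 ^ k) = n1 at *
  have h5 : n0 ≤ 4 := by omega
  interval_cases n0 <;> omega

/-- Without the prime `3` all primes of `t` exceed the class size, so the two halves balance
exactly. -/
lemma VanishesAt.dyadicCard_half (h : VanishesAt A 1 (2 ^ (k + 1) * t)) (ht : Nat.Coprime 2 t)
    (ht0 : 0 < t) (ht3 : Nat.Coprime 3 t) (h4 : dyadicCard A k x ≤ 4) :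
    dyadicCard A k x = 2 * dyadicCard A (k + 1) x := by
  have h1 := (h.dyadic_class ht x).sum_eq_zero ht0 fun l hl hlt => by
    refine lt_of_le_of_lt h4 ?_
    exact five_le_prime hl (ne_of_coprime_of_dvd Nat.prime_two ht hlt)
      (ne_of_coprime_of_dvd Nat.prime_three ht3 hlt)
  rw [dyadic_sum_eq] at h1
  have h2 := dyadicCard_succ_add (A := A) (k := k) (x := x)
  omega

lemma VanishesAt.of_forall_modEq (h : VanishesAt A 1 (2 ^ (k + 1) * t)) (ht : Nat.Coprime 2 t)
    (hA : ∀ x ∈ A, ∀ y ∈ A, x ≡ y [MOD 2 ^ (k + 1)]) : VanishesAt A 1 t := by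
  rcases A.eq_empty_or_nonempty with rfl | ⟨x, hx⟩
  · intro η _; simp
  have h1 := h.of_empty_sibling Nat.prime_two ht (v := x) (v' := x + 2 ^ k) (by simp [Nat.ModEq])
    fun a ha hmod => not_modEq_add_mul_pow (p := 2) (k := k) (a := x) one_pos one_lt_two
      (by rw [one_mul]; exact hmod.symm.trans (hA a ha x hx))
  rwa [Finset.filter_true_of_mem fun a ha => hA a ha x hx] at h1

/-- At two successive vanishing levels, no dyadic class at the first of them has at most two
elements. -/
lemma not_two_levels {k₁ k₂ t₁ t₂ : ℕ} (hk : k₁ < k₂) (h₁ : VanishesAt A 1 (2 ^ (k₁ + 1) * t₁))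
    (h₂ : VanishesAt A 1 (2 ^ (k₂ + 1) * t₂)) (ht₁ : Nat.Coprime 2 t₁) (ht₂ : Nat.Coprime 2 t₂)
    (h₁0 : 0 < t₁) (h₂0 : 0 < t₂) (hx : x ∈ A) : 3 ≤ dyadicCard A k₁ x := by
  by_contra! hlt
  -- A class of size at most two must split as `1 + 1`, leaving a singleton at the later level,
  -- which cannot occur at a vanishing level.
  have a1 := h₁.dyadicCard_small ht₁ h₁0 hx (by omega)
  have a2 := dyadicCard_anti (A := A) (x := x) (show k₁ + 1 ≤ k₂ from hk)
  have a3 := h₂.dyadicCard_small ht₂ h₂0 hx (by omega)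
  omega

end dyadic

/-! ### Bounding the number of exponents for small cardinalities -/

/-- Increasing exponents of `q` in the accumulating set, with the corresponding vanishing
orders. -/
lemma exists_levels {A : Finset ℕ} {q m : ℕ} (hq : q.Prime)
    (hdvd : ∀ s ∈ accumulatingDivisors A, q ∣ s) (hm : m ≤ (accumulatingLevels A q).card) :
    ∃ k t : Fin m → ℕ, StrictMono k ∧ ∀ i, 0 < t i ∧ q.Coprime (t i) ∧
      (t i).Coprime A.card ∧ VanishesAt A 1 (q ^ (k i + 1) * t i) := by
  choose! k t h1 h2 h3 h4 using fun b hb =>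
    exists_of_mem_accumulatingLevels (A := A) (b := b) hq hdvd hb
  set e := (accumulatingLevels A q).orderEmbOfCardLe hm
  have he : ∀ i, e i ∈ accumulatingLevels A q := fun i => Finset.orderEmbOfCardLe_mem _ hm i
  refine ⟨fun i => k (e i), fun i => t (e i), fun i j hij => ?_, fun i => ⟨h2 _ (he i), h3 _ (he i),
    (coprime_card_of_mem (h4 _ (he i))).coprime_dvd_left (dvd_mul_left _ _),
    vanishesAt_of_mem (h4 _ (he i))⟩⟩
  have hlt : e i < e j := e.strictMono hij
  have a1 := h1 _ (he i)
  have a2 := h1 _ (he j)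
  show k (e i) < k (e j)
  omega

/-- If `A` vanishes at no order coprime to `q` and `#A`, then `q` divides the accumulating set. -/
lemma dvd_of_not_vanishesAt {A : Finset ℕ} {q : ℕ} (hq : q.Prime)
    (hn : ∀ t, 0 < t → q.Coprime t → t.Coprime A.card → ¬ VanishesAt A 1 t) :
    ∀ s ∈ accumulatingDivisors A, q ∣ s := by
  intro s hs
  by_contra hqs
  exact hn s (pos_of_mem_accumulatingDivisors hs) (hq.coprime_iff_not_dvd.2 hqs)
    (coprime_card_of_mem hs) (vanishesAt_of_mem hs)

/-- Two levels yield transversals `U`, `V` of size `q`. All of `V` lies in one class at the finer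
scale, which meets `U` at most once, so the union has at least `2 * q - 1` elements. -/
lemma card_levels_le_one {A : Finset ℕ} {q : ℕ} (hq : q.Prime) (hlt : A.card + 1 < 2 * q)
    (hn : ∀ t, 0 < t → q.Coprime t → t.Coprime A.card → ¬ VanishesAt A 1 t) :
    (accumulatingLevels A q).card ≤ 1 := by
  by_contra! hcon
  obtain ⟨k, t, hk, h⟩ := exists_levels hq (dvd_of_not_vanishesAt hq hn) hcon
  obtain ⟨a1, a2, a3, a4⟩ := h 0
  obtain ⟨b1, b2, b3, b4⟩ := h 1
  obtain ⟨U, hU, hUc, -, hUd⟩ := a4.exists_transversal hq a2 (hn _ a1 a2 a3)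
  obtain ⟨V, hV, hVc, hVe, -⟩ := b4.exists_transversal hq b2 (hn _ b1 b2 b3)
  have hkk : k 0 + 1 ≤ k 1 := hk (by decide)
  have h1 : (U ∩ V).card ≤ 1 := by
    refine Finset.card_le_one.2 fun a ha b hb => ?_
    rw [Finset.mem_inter] at ha hb
    exact hUd a ha.1 b hb.1 ((hVe a ha.2 b hb.2).of_dvd (pow_dvd_pow q hkk))
  have h2 := Finset.card_union_add_card_inter U V
  have h3 := Finset.card_le_card (Finset.union_subset hU hV)
  omega

/-- With three levels, each class at the second has at least three elements, so there is only one
class. Then `A` does not split at the first level and vanishes at an excluded order. -/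
lemma card_levels_le_two_of_card_five {A : Finset ℕ} (hA : A.card = 5)
    (hn : ∀ t, 0 < t → Nat.Coprime 2 t → t.Coprime A.card → ¬ VanishesAt A 1 t) :
    (accumulatingLevels A 2).card ≤ 2 := by
  by_contra! hcon
  obtain ⟨k, t, hk, h⟩ := exists_levels Nat.prime_two (dvd_of_not_vanishesAt Nat.prime_two hn) hcon
  obtain ⟨a1, a2, a3, a4⟩ := h 0
  obtain ⟨b1, b2, b3, b4⟩ := h 1
  obtain ⟨c1, c2, c3, c4⟩ := h 2
  have h01 : k 0 + 1 ≤ k 1 := hk (by decide)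
  have h12 : k 1 < k 2 := hk (by decide)
  refine hn _ a1 a2 a3 (a4.of_forall_modEq a2 fun x hx y hy => ?_)
  refine Nat.ModEq.of_dvd (pow_dvd_pow 2 h01) ?_
  by_contra hxy
  have e1 := dyadicCard_add_le (A := A) hxy
  have e2 := not_two_levels h12 b4 c4 b2 c2 b1 c1 hx
  have e3 := not_two_levels h12 b4 c4 b2 c2 b1 c1 hy
  omega

/-- Coprimality to `9` removes the prime `3`, so a class of at most four elements at the second of
four levels would halve to at most two, which the last two levels forbid. Classes of at least five
elements leave room for only one. -/
lemma card_levels_le_three_of_card_nine {A : Finset ℕ} (hA : A.card = 9)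
    (hn : ∀ t, 0 < t → Nat.Coprime 2 t → t.Coprime A.card → ¬ VanishesAt A 1 t) :
    (accumulatingLevels A 2).card ≤ 3 := by
  by_contra! hcon
  obtain ⟨k, t, hk, h⟩ := exists_levels Nat.prime_two (dvd_of_not_vanishesAt Nat.prime_two hn) hcon
  obtain ⟨a1, a2, a3, a4⟩ := h 0
  obtain ⟨b1, b2, b3, b4⟩ := h 1
  obtain ⟨c1, c2, c3, c4⟩ := h 2
  obtain ⟨d1, d2, d3, d4⟩ := h 3
  have h01 : k 0 + 1 ≤ k 1 := hk (by decide)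
  have h12 : k 1 + 1 ≤ k 2 := hk (by decide)
  have h23 : k 2 < k 3 := hk (by decide)
  have h3 : ∀ t : ℕ, t.Coprime A.card → Nat.Coprime 3 t := by
    intro t ht
    rw [hA] at ht
    exact (ht.coprime_dvd_right (by norm_num)).symm
  have hlarge : ∀ x ∈ A, 5 ≤ dyadicCard A (k 1) x := by
    intro x hx
    by_contra! hlt
    have e1 := b4.dyadicCard_half b2 b1 (h3 _ b3) (x := x) (by omega)
    have e2 := dyadicCard_anti (A := A) (x := x) h12
    have e3 := not_two_levels h23 c4 d4 c2 d2 c1 d1 hx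
    omega
  refine hn _ a1 a2 a3 (a4.of_forall_modEq a2 fun x hx y hy => ?_)
  refine Nat.ModEq.of_dvd (pow_dvd_pow 2 h01) ?_
  by_contra hxy
  have e1 := dyadicCard_add_le (A := A) hxy
  have e2 := hlarge x hx
  have e3 := hlarge y hy
  omega

/-- A three-element set vanishing at odd order is a single `3`-fiber. -/
lemma VanishesAt.triadic_fiber {W : Finset ℕ} {t : ℕ} (h : VanishesAt W 1 t) (hW : W.card = 3)
    (ht : 0 < t) (ht2 : Nat.Coprime 2 t) :
    ∃ c r, t = 3 ^ (c + 1) * r ∧ Nat.Coprime 3 r ∧ 0 < r ∧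
      (∀ a ∈ W, ∀ b ∈ W, a ≡ b [MOD 3 ^ c]) ∧
      ∀ a ∈ W, ∀ b ∈ W, a ≡ b [MOD 3 ^ (c + 1)] → a = b := by
  have hnv : ∀ r, 0 < r → r ∣ t → Nat.Coprime 3 r → ¬ VanishesAt W 1 r := by
    intro r hr hrt h3 hv
    have := hv.sum_eq_zero hr fun l hl hlr => by
      have := five_le_prime hl (ne_of_coprime_of_dvd Nat.prime_two ht2 (hlr.trans hrt))
        (ne_of_coprime_of_dvd Nat.prime_three h3 hlr)
      omega
    simp at this
    simp [this] at hW
  have h3 : 3 ∣ t := by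
    by_contra h3
    exact hnv t ht dvd_rfl (Nat.prime_three.coprime_iff_not_dvd.2 h3) h
  obtain ⟨c, r, rfl, h3r, hr⟩ := exists_eq_prime_pow_succ_mul Nat.prime_three ht h3
  obtain ⟨U, hU, hUc, h1, h2⟩ :=
    h.exists_transversal Nat.prime_three h3r (hnv r hr (dvd_mul_left _ _) h3r)
  obtain rfl : U = W := Finset.eq_of_subset_of_card_le hU (by omega)
  exact ⟨c, r, rfl, h3r, hr, h1, h2⟩

/-- Applied in both directions, it identifies the triadic scales of the same fiber found at two
dyadic levels. -/
lemma triadic_level_unique {W : Finset ℕ} {c c' : ℕ} (hW : W.card = 3)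
    (h1 : ∀ a ∈ W, ∀ b ∈ W, a ≡ b [MOD 3 ^ c'])
    (h2 : ∀ a ∈ W, ∀ b ∈ W, a ≡ b [MOD 3 ^ (c + 1)] → a = b) : c' ≤ c := by
  by_contra! hlt
  have : W.card ≤ 1 := Finset.card_le_one.2 fun a ha b hb =>
    h2 a ha b hb ((h1 a ha b hb).of_dvd (pow_dvd_pow 3 hlt))
  omega

/-- No signed sum of a `3`-fiber `W` and a four-element set `Q` contained in one class modulo the
scale of `W` vanishes at an order coprime to `2` and `7`. -/
lemma not_vanishesAt_three_sub_four {W Q : Finset ℕ} {c t : ℕ} (hd : Disjoint W Q)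
    (hW : W.card = 3) (hQ : Q.card = 4) (hWc : ∀ a ∈ W, ∀ b ∈ W, a ≡ b [MOD 3 ^ c])
    (hWd : ∀ a ∈ W, ∀ b ∈ W, a ≡ b [MOD 3 ^ (c + 1)] → a = b)
    (hQc : ∀ a ∈ Q, ∀ b ∈ Q, a ≡ b [MOD 3 ^ (c + 1)]) (ht : 0 < t) (ht2 : Nat.Coprime 2 t)
    (ht7 : Nat.Coprime 7 t) (h : VanishesAt (W ∪ Q) (fun a => if a ∈ W then 1 else -1) t) :
    False := by
  have hcard : (W ∪ Q).card = 7 := by rw [Finset.card_union_of_disjoint hd, hW, hQ]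
  have hS : ∀ P : ℕ → Prop, ∀ [DecidablePred P],
      ∑ a ∈ W ∪ Q with P a, (if a ∈ W then 1 else -1 : ℤ) =
        (W.filter P).card - (Q.filter P).card := by
    intro P _
    rw [Finset.filter_union, Finset.sum_union (Finset.disjoint_filter_filter hd),
      Finset.sum_congr rfl (g := fun _ => (1 : ℤ)) (s₁ := W.filter P),
      Finset.sum_congr rfl (g := fun _ => (-1 : ℤ)) (s₁ := Q.filter P)]
    · simp; ring
    · intro a ha
      exact if_neg fun hw => Finset.disjoint_left.1 hd hw (Finset.mem_filter.1 ha).1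
    · intro a ha
      exact if_pos (Finset.mem_filter.1 ha).1
  by_cases h3 : 3 ∣ t
  swap
  -- Apart from `5`, the primes of `t` are at least `11`, exceeding the seven elements; but the
  -- total weight `3 - 4 = -1` is not divisible by `5`.
  · have h1 := h.dvd_sum Nat.prime_five ht fun l hl hlt h5 => by
      have := eleven_le_prime hl (ne_of_coprime_of_dvd Nat.prime_two ht2 hlt)
        (by rintro rfl; exact h3 hlt) h5 (ne_of_coprime_of_dvd (by norm_num) ht7 hlt)
      omega
    have h2 := hS (fun _ => True)
    simp only [Finset.filter_true, hW, hQ] at h2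
    rw [h2] at h1
    norm_num at h1
  obtain ⟨k, r, rfl, h3r, hr⟩ := exists_eq_prime_pow_succ_mul Nat.prime_three ht h3
  have hcong : ∀ v v', v ≡ v' [MOD 3 ^ k] →
      (5 : ℤ) ∣ ((W.filter (· ≡ v [MOD 3 ^ (k + 1)])).card -
        (Q.filter (· ≡ v [MOD 3 ^ (k + 1)])).card : ℤ) -
        ((W.filter (· ≡ v' [MOD 3 ^ (k + 1)])).card -
        (Q.filter (· ≡ v' [MOD 3 ^ (k + 1)])).card) := by
    intro v v' hv
    have h1 := h.dvd_class_sum_sub Nat.prime_five Nat.prime_three h3r hr (fun l hl hlt h5 => by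
      have := eleven_le_prime hl
        (ne_of_coprime_of_dvd Nat.prime_two ht2 (hlt.mul_left _))
        (ne_of_coprime_of_dvd Nat.prime_three h3r hlt) h5
        (ne_of_coprime_of_dvd (by norm_num) ht7 (hlt.mul_left _))
      omega) hv
    rw [hS, hS] at h1
    exact_mod_cast h1
  obtain ⟨w₁, w₂, w₃, h12, h13, h23, hWe⟩ := Finset.card_eq_three.1 hW
  have m1 : w₁ ∈ W := by simp [hWe]
  have m2 : w₂ ∈ W := by simp [hWe]
  have m3 : w₃ ∈ W := by simp [hWe]
  obtain ⟨q, hq⟩ : Q.Nonempty := Finset.card_pos.1 (by omega)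
  have hall : ∀ {B : Finset ℕ} {v m : ℕ}, (∀ a ∈ B, a ≡ v [MOD m]) →
      (B.filter (· ≡ v [MOD m])).card = B.card := fun hB => by
    rw [Finset.filter_true_of_mem hB]
  have hnone : ∀ {B : Finset ℕ} {v m : ℕ}, (∀ a ∈ B, ¬ a ≡ v [MOD m]) →
      (B.filter (· ≡ v [MOD m])).card = 0 := fun hB => by
    rw [Finset.filter_false_of_mem hB, Finset.card_empty]
  -- Sibling weights modulo `3 ^ (k + 1)` must agree modulo `5`. For `k < c`, each of `W` and `Q`
  -- lies in one class; the class of `W` has weight `3` or `-1`, against an empty sibling.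
  rcases lt_or_ge k c with hkc | hck
  · have hWk : ∀ a ∈ W, a ≡ w₁ [MOD 3 ^ (k + 1)] := fun a ha =>
      (hWc a ha w₁ m1).of_dvd (pow_dvd_pow 3 hkc)
    have hQk : ∀ a ∈ Q, a ≡ q [MOD 3 ^ (k + 1)] := fun a ha =>
      (hQc a ha q hq).of_dvd (pow_dvd_pow 3 (by omega))
    obtain ⟨i, hi0, hi3, hiq⟩ : ∃ i, 0 < i ∧ i < 3 ∧ ¬ q ≡ w₁ + i * 3 ^ k [MOD 3 ^ (k + 1)] := by
      by_contra! hcon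
      have e := (hcon 1 (by norm_num) (by norm_num)).symm.trans (hcon 2 (by norm_num) (by norm_num))
      refine not_modEq_add_mul_pow (p := 3) (k := k) (a := w₁ + 1 * 3 ^ k) (i := 1)
        (by norm_num) (by norm_num) ?_
      rw [add_assoc, ← add_mul]
      exact e.symm
    have h1 := hcong w₁ (w₁ + i * 3 ^ k) (by simp [Nat.ModEq])
    rw [hall hWk, hnone fun a ha h' => not_modEq_add_mul_pow (p := 3) hi0 hi3
        (h'.symm.trans (hWk a ha)),
      hnone (B := Q) (v := w₁ + i * 3 ^ k) fun a ha h' => hiq ((hQk a ha).symm.trans h')] at h1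
    by_cases hqw : q ≡ w₁ [MOD 3 ^ (k + 1)]
    · rw [hall fun a ha => (hQk a ha).trans hqw, hW, hQ] at h1
      norm_num at h1
    · rw [hnone fun a ha h' => hqw ((hQk a ha).symm.trans h'), hW] at h1
      norm_num at h1
  have hWone : ∀ w ∈ W, (W.filter (· ≡ w [MOD 3 ^ (k + 1)])).card = 1 := by
    intro w hw
    rw [Finset.card_eq_one]
    refine ⟨w, Finset.eq_singleton_iff_unique_mem.2
      ⟨Finset.mem_filter.2 ⟨hw, Nat.ModEq.refl w⟩, fun a ha => ?_⟩⟩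
    rw [Finset.mem_filter] at ha
    exact hWd a ha.1 w hw (ha.2.of_dvd (pow_dvd_pow 3 (by omega)))
  have hex : ∃ w ∈ W, ¬ q ≡ w [MOD 3 ^ (c + 1)] := by
    by_contra! hcon
    exact h12 (hWd _ m1 _ m2 ((hcon _ m1).symm.trans (hcon _ m2)))
  obtain ⟨w, hw, hqw⟩ := hex
  have hQw : ∀ m, c + 1 ≤ m → (Q.filter (· ≡ w [MOD 3 ^ m])).card = 0 := fun m hm =>
    hnone fun a ha h' => hqw ((hQc q hq a ha).trans (h'.of_dvd (pow_dvd_pow 3 hm)))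
  -- For `k > c`, the class of `w` has weight `1` and a sibling has weight `0`. For `k = c`, the
  -- conflict is `1` against `1 - 4` if `Q` shares the parent class of `W`, and `-4` against `0`
  -- otherwise.
  rcases hck.lt_or_eq with hlt | rfl
  · have h1 := hcong w (w + 1 * 3 ^ k) (by simp [Nat.ModEq])
    have hk : ∀ {a}, a ≡ w + 1 * 3 ^ k [MOD 3 ^ (k + 1)] → a ≡ w [MOD 3 ^ (c + 1)] := fun {a} ha =>
      ((ha.of_dvd (pow_dvd_pow 3 (Nat.le_succ k))).trans (by simp [Nat.ModEq])).of_dvd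
        (pow_dvd_pow 3 hlt)
    rw [hWone w hw, hQw _ (by omega), hnone fun a ha h' => ?_, hnone fun a ha h' => ?_] at h1
    · norm_num at h1
    · exact hqw ((hQc q hq a ha).trans (hk h'))
    · rw [hWd a ha w hw (hk h')] at h'
      exact not_modEq_add_mul_pow (p := 3) one_pos (by norm_num) h'.symm
  · have hQq : ∀ v, q ≡ v [MOD 3 ^ (c + 1)] →
        (Q.filter (· ≡ v [MOD 3 ^ (c + 1)])).card = 4 := fun v hv => by
      rw [hall fun a ha => (hQc a ha q hq).trans hv, hQ]
    by_cases hqW : q ≡ w [MOD 3 ^ c]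
    · obtain ⟨w', hw', hqw'⟩ : ∃ w' ∈ W, q ≡ w' [MOD 3 ^ (c + 1)] := by
        by_contra! hcon
        obtain ⟨i, hi, ei⟩ := exists_digit (m := 3) (by norm_num) hqW
        obtain ⟨i₁, hi₁, ei₁⟩ := exists_digit (m := 3) (by norm_num) (hWc w₁ m1 w hw)
        obtain ⟨i₂, hi₂, ei₂⟩ := exists_digit (m := 3) (by norm_num) (hWc w₂ m2 w hw)
        obtain ⟨i₃, hi₃, ei₃⟩ := exists_digit (m := 3) (by norm_num) (hWc w₃ m3 w hw)
        have n1 : i ≠ i₁ := by rintro rfl; exact hcon _ m1 (ei.trans ei₁.symm)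
        have n2 : i ≠ i₂ := by rintro rfl; exact hcon _ m2 (ei.trans ei₂.symm)
        have n3 : i ≠ i₃ := by rintro rfl; exact hcon _ m3 (ei.trans ei₃.symm)
        have n4 : i₁ ≠ i₂ := by rintro rfl; exact h12 (hWd _ m1 _ m2 (ei₁.trans ei₂.symm))
        have n5 : i₁ ≠ i₃ := by rintro rfl; exact h13 (hWd _ m1 _ m3 (ei₁.trans ei₃.symm))
        have n6 : i₂ ≠ i₃ := by rintro rfl; exact h23 (hWd _ m2 _ m3 (ei₂.trans ei₃.symm))
        omega
      have h1 := hcong w w' (hWc w hw w' hw')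
      rw [hWone w hw, hWone w' hw', hQw _ le_rfl, hQq w' hqw'] at h1
      norm_num at h1
    · have h1 := hcong q (q + 1 * 3 ^ c) (by simp [Nat.ModEq])
      rw [hQq q rfl, hnone fun a ha h' => ?_, hnone fun a ha h' => ?_, hnone fun a ha h' => ?_] at h1
      · norm_num at h1
      · exact not_modEq_add_mul_pow (p := 3) one_pos (by norm_num) (h'.symm.trans (hQc a ha q hq))
      · exact hqW (((h'.of_dvd (pow_dvd_pow 3 (Nat.le_succ c))).trans
          (by simp [Nat.ModEq])).symm.trans (hWc a ha w hw))
      · exact hqW ((h'.of_dvd (pow_dvd_pow 3 (Nat.le_succ c))).symm.trans (hWc a ha w hw))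

/-- A four-element set split as `2 + 2` and then `1 + 1` by dyadic levels lies in a single class
modulo the `3`-part of the first order, provided that this divides the second. -/
lemma modEq_of_dyadic_splitting {A Q : Finset ℕ} {k₂ k₃ t₃ c r : ℕ} (hk : k₂ + 1 ≤ k₃)
    (h₂ : VanishesAt A 1 (2 ^ (k₂ + 1) * (3 ^ (c + 1) * r)))
    (h₃ : VanishesAt A 1 (2 ^ (k₃ + 1) * t₃))
    (h2r : Nat.Coprime 2 (3 ^ (c + 1) * r)) (h3r : Nat.Coprime 3 r) (hr : 0 < r)
    (h2t : Nat.Coprime 2 t₃) (ht₃ : 0 < t₃) (hc : 3 ^ (c + 1) ∣ t₃)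
    (hQc : ∀ a ∈ Q, Q = A.filter (· ≡ a [MOD 2 ^ k₂])) (hQ : Q.card = 4) :
    ∀ a ∈ Q, ∀ b ∈ Q, a ≡ b [MOD 3 ^ (c + 1)] := by
  have hQA : Q ⊆ A := by
    intro a ha
    have := hQc a ha
    rw [this] at ha
    exact (Finset.mem_filter.1 ha).1
  have hN2 : ∀ a ∈ Q, dyadicCard A k₂ a = 4 := fun a ha => by
    rw [dyadicCard, ← hQc a ha, hQ]
  have hN2' : ∀ a ∈ Q, dyadicCard A (k₂ + 1) a = 2 := fun a ha => by
    have h1 := h₂.dyadicCard_small h2r (by positivity) (hQA ha) (hN2 a ha).le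
    have h2 := hN2 a ha
    omega
  have hN3 : ∀ a ∈ Q, dyadicCard A k₃ a = 2 ∧ dyadicCard A (k₃ + 1) a = 1 := fun a ha => by
    have h1 := dyadicCard_anti (A := A) (x := a) hk
    have h2 := hN2' a ha
    have h3 := h₃.dyadicCard_small h2t ht₃ (hQA ha) (by omega)
    omega
  -- A pair sharing a half at level `k₂` persists to level `k₃` and separates there. The class sums
  -- are then single terms, so `η ^ a = η ^ b` for `η` of order `t₃`, giving congruence modulo `t₃`.
  have hpair : ∀ a ∈ Q, ∀ b ∈ Q, a ≡ b [MOD 2 ^ (k₂ + 1)] → a ≡ b [MOD 3 ^ (c + 1)] := by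
    intro a ha b hb hab
    rcases eq_or_ne a b with rfl | hne
    · rfl
    have hsub : A.filter (· ≡ a [MOD 2 ^ k₃]) = A.filter (· ≡ a [MOD 2 ^ (k₂ + 1)]) := by
      refine Finset.eq_of_subset_of_card_le (Finset.monotone_filter_right _
        fun _ _ h => Nat.ModEq.of_dvd (pow_dvd_pow 2 hk) h) ?_
      exact ((hN2' a ha).trans (hN3 a ha).1.symm).le
    have hab3 : b ≡ a [MOD 2 ^ k₃] := by
      have : b ∈ A.filter (· ≡ a [MOD 2 ^ k₃]) := by
        rw [hsub]; exact Finset.mem_filter.2 ⟨hQA hb, hab.symm⟩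
      exact (Finset.mem_filter.1 this).2
    have hone : ∀ x ∈ Q, A.filter (· ≡ x [MOD 2 ^ (k₃ + 1)]) = {x} := by
      intro x hx
      obtain ⟨y, hy⟩ := Finset.card_eq_one.1 (hN3 x hx).2
      have : x ∈ A.filter (· ≡ x [MOD 2 ^ (k₃ + 1)]) :=
        Finset.mem_filter.2 ⟨hQA hx, Nat.ModEq.refl x⟩
      rw [hy, Finset.mem_singleton] at this
      rw [hy, this]
    obtain ⟨η, hη⟩ : ∃ η : ℂ, IsPrimitiveRoot η t₃ := ⟨_, Complex.isPrimitiveRoot_exp t₃ ht₃.ne'⟩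
    have h1 := h₃.class_sum_eq Nat.prime_two h2t hab3 hη
    rw [hone a ha, hone b hb, Finset.sum_singleton, Finset.sum_singleton] at h1
    simp only [Pi.one_apply, Int.cast_one, one_mul] at h1
    have h2 : b ≡ a [MOD t₃] := hη.pow_inj (Nat.mod_lt _ ht₃) (Nat.mod_lt _ ht₃)
      (by rw [hη.eq_orderOf, pow_mod_orderOf, pow_mod_orderOf, h1])
    exact (h2.of_dvd hc).symm
  intro a ha b hb
  by_contra hab
  have hab2 : ¬ a ≡ b [MOD 2 ^ (k₂ + 1)] := fun h => hab (hpair a ha b hb h)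
  have hba : b ≡ a [MOD 2 ^ k₂] := by
    have : b ∈ A.filter (· ≡ a [MOD 2 ^ k₂]) := by rwa [← hQc a ha]
    exact (Finset.mem_filter.1 this).2
  have hsplit : ∀ x ∈ Q, x ≡ a [MOD 2 ^ (k₂ + 1)] ∨ x ≡ b [MOD 2 ^ (k₂ + 1)] := by
    intro x hx
    by_contra! hcon
    have hd : ∀ u ∈ Q, Q.filter (· ≡ u [MOD 2 ^ (k₂ + 1)]) = A.filter (· ≡ u [MOD 2 ^ (k₂ + 1)]) := by
      intro u hu
      ext y
      simp only [Finset.mem_filter]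
      refine ⟨fun h => ⟨hQA h.1, h.2⟩, fun h => ⟨?_, h.2⟩⟩
      rw [hQc u hu]
      exact Finset.mem_filter.2 ⟨h.1, h.2.of_dvd (pow_dvd_pow 2 (Nat.le_succ _))⟩
    have e1 : dyadicCard Q (k₂ + 1) a = 2 := by rw [dyadicCard, hd a ha]; exact hN2' a ha
    have e2 : dyadicCard Q (k₂ + 1) b = 2 := by rw [dyadicCard, hd b hb]; exact hN2' b hb
    have e3 : (Q.filter (· ≡ a [MOD 2 ^ (k₂ + 1)]) ∪ Q.filter (· ≡ b [MOD 2 ^ (k₂ + 1)])) = Q := by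
      refine Finset.eq_of_subset_of_card_le
        (Finset.union_subset (Finset.filter_subset _ _) (Finset.filter_subset _ _)) ?_
      rw [Finset.card_union_of_disjoint, hQ]
      · exact (by rw [dyadicCard] at e1 e2; omega)
      · rw [Finset.disjoint_filter]
        exact fun y _ h1 h2 => hab2 (h1.symm.trans h2)
    rw [← e3, Finset.mem_union, Finset.mem_filter, Finset.mem_filter] at hx
    rcases hx with h | h
    · exact hcon.1 h.2
    · exact hcon.2 h.2
  set g : ℕ → ℤ := fun x => (if x ≡ a [MOD 2 ^ (k₂ + 1)] then 1 else 0) -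
    (if x ≡ b [MOD 2 ^ (k₂ + 1)] then 1 else 0) with hg
  have hvan : VanishesAt Q g (3 ^ (c + 1) * r) := by
    refine (h₂.class_diff Nat.prime_two h2r hba.symm).restrict hQA fun x hx hxQ => ?_
    have : ∀ u ∈ Q, ¬ x ≡ u [MOD 2 ^ (k₂ + 1)] := by
      intro u hu h
      refine hxQ ?_
      rw [hQc u hu]
      exact Finset.mem_filter.2 ⟨hx, h.of_dvd (pow_dvd_pow 2 (Nat.le_succ _))⟩
    rw [if_neg (this a ha), if_neg (this b hb), sub_zero]
  have hv0 := (hvan.class_diff Nat.prime_three h3r (v := a) (v' := a + 1 * 3 ^ c)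
    (by simp [Nat.ModEq])).sum_eq_zero hr fun l hl hlr => by
      have := five_le_prime hl (ne_of_coprime_of_dvd Nat.prime_two h2r (hlr.mul_left _))
        (ne_of_coprime_of_dvd Nat.prime_three h3r hlr)
      omega
  -- If the pairs lay in different triadic classes, the pair of `a` would contribute `1` per
  -- element, and the other pair, of weight `-1`, would contribute `0` or `1`. The sum could not be
  -- zero.
  have hpos : 0 < ∑ x ∈ Q, ((if x ≡ a [MOD 3 ^ (c + 1)] then g x else 0) -
      (if x ≡ a + 1 * 3 ^ c [MOD 3 ^ (c + 1)] then g x else 0)) := by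
    refine Finset.sum_pos' (fun x hx => ?_) ⟨a, ha, ?_⟩
    · rcases hsplit x hx with h | h
      · have h3 := hpair x hx a ha h
        have hgx : g x = 1 := by
          simp only [hg]
          rw [if_pos h, if_neg fun h' => hab2 (h.symm.trans h'), sub_zero]
        rw [if_pos h3, if_neg fun h' => not_modEq_add_mul_pow (p := 3) one_pos (by norm_num)
          (h'.symm.trans h3), hgx]
        norm_num
      · have h3 := hpair x hx b hb h
        have hgx : g x = -1 := by
          simp only [hg]
          rw [if_pos h, if_neg fun h' => hab2 (h'.symm.trans h), zero_sub]
        rw [if_neg fun h' => hab (h'.symm.trans h3), hgx]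
        split_ifs <;> norm_num
    · have hga : g a = 1 := by
        simp only [hg]
        rw [if_pos (Nat.ModEq.refl a), if_neg hab2, sub_zero]
      rw [if_pos (Nat.ModEq.refl a), if_neg fun h' => not_modEq_add_mul_pow (p := 3) one_pos (by norm_num)
        h'.symm, hga]
      norm_num
  omega

/-- If all dyadic classes of a seven-element set have at least three elements and there is more than
one class, then there are two classes, with three and four elements. -/
lemma exists_three_four_classes {A : Finset ℕ} {k x y : ℕ} (hA : A.card = 7)
    (h3 : ∀ x ∈ A, 3 ≤ dyadicCard A k x) (hx : x ∈ A) (hy : y ∈ A) (hxy : ¬ x ≡ y [MOD 2 ^ k]) :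
    ∃ w ∈ A, ∃ q ∈ A, ¬ w ≡ q [MOD 2 ^ k] ∧ dyadicCard A k w = 3 ∧ dyadicCard A k q = 4 ∧
      ∀ z ∈ A, z ≡ w [MOD 2 ^ k] ∨ z ≡ q [MOD 2 ^ k] := by
  have hdisj : Disjoint (A.filter (· ≡ x [MOD 2 ^ k])) (A.filter (· ≡ y [MOD 2 ^ k])) := by
    rw [Finset.disjoint_filter]
    exact fun a _ h1 h2 => hxy (h1.symm.trans h2)
  have hcard := Finset.card_union_of_disjoint hdisj
  have hcov : ∀ z ∈ A, z ≡ x [MOD 2 ^ k] ∨ z ≡ y [MOD 2 ^ k] := by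
    intro z hz
    by_contra! hcon
    have hd : Disjoint (A.filter (· ≡ x [MOD 2 ^ k]) ∪ A.filter (· ≡ y [MOD 2 ^ k]))
        (A.filter (· ≡ z [MOD 2 ^ k])) := by
      rw [Finset.disjoint_union_left, Finset.disjoint_filter, Finset.disjoint_filter]
      exact ⟨fun a _ h1 h2 => hcon.1 (h2.symm.trans h1), fun a _ h1 h2 => hcon.2 (h2.symm.trans h1)⟩
    have h1 := Finset.card_union_of_disjoint hd
    have h2 := Finset.card_le_card (Finset.union_subset (Finset.union_subset
      (Finset.filter_subset (· ≡ x [MOD 2 ^ k]) A) (Finset.filter_subset (· ≡ y [MOD 2 ^ k]) A))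
      (Finset.filter_subset (· ≡ z [MOD 2 ^ k]) A))
    have a1 := h3 x hx
    have a2 := h3 y hy
    have a3 := h3 z hz
    simp only [dyadicCard] at a1 a2 a3
    omega
  have huni : A.filter (· ≡ x [MOD 2 ^ k]) ∪ A.filter (· ≡ y [MOD 2 ^ k]) = A := by
    rw [← Finset.filter_or, Finset.filter_true_of_mem hcov]
  rw [huni, hA] at hcard
  have a1 := h3 x hx
  have a2 := h3 y hy
  rcases eq_or_ne (dyadicCard A k x) 3 with h | h
  · exact ⟨x, hx, y, hy, hxy, h, by simp only [dyadicCard] at *; omega, hcov⟩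
  · refine ⟨y, hy, x, hx, fun h => hxy h.symm, ?_, ?_, fun z hz => (hcov z hz).symm⟩ <;>
      (simp only [dyadicCard] at *; omega)

/-- A dyadic class that does not split at a vanishing level vanishes at the odd part. -/
lemma VanishesAt.class_of_card_eq {A : Finset ℕ} {k t w : ℕ}
    (h : VanishesAt A 1 (2 ^ (k + 1) * t)) (ht : Nat.Coprime 2 t)
    (hw : dyadicCard A (k + 1) w = dyadicCard A k w) :
    VanishesAt (A.filter (· ≡ w [MOD 2 ^ k])) 1 t := by
  have h1 := dyadicCard_succ_add (A := A) (k := k) (x := w)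
  have h2 : dyadicCard A (k + 1) (w + 2 ^ k) = 0 := by omega
  have h3 := h.of_empty_sibling Nat.prime_two ht (v := w) (v' := w + 2 ^ k) (by simp [Nat.ModEq])
    fun a ha h' => Finset.notMem_empty a
      (Finset.card_eq_zero.1 h2 ▸ Finset.mem_filter.2 ⟨ha, h'⟩)
  have h4 : A.filter (· ≡ w [MOD 2 ^ (k + 1)]) = A.filter (· ≡ w [MOD 2 ^ k]) :=
    Finset.eq_of_subset_of_card_le (Finset.monotone_filter_right _
      fun _ _ h => Nat.ModEq.of_dvd (pow_dvd_pow 2 (Nat.le_succ k)) h) hw.ge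
  rwa [h4] at h3

/-- Three levels force `A` to split into classes `W` of size three and `Q` of size four at the
second. `W` does not split at the second or third level, so it is a `3`-fiber; `Q` splits as `2 + 2`
and then `1 + 1`, so it lies in one class modulo the scale of `W`. The first level separates `W`
from `Q`, and the resulting signed sum cannot vanish. -/
lemma card_levels_le_two_of_card_seven {A : Finset ℕ} (hA : A.card = 7)
    (hn : ∀ t, 0 < t → Nat.Coprime 2 t → t.Coprime A.card → ¬ VanishesAt A 1 t) :
    (accumulatingLevels A 2).card ≤ 2 := by
  by_contra! hcon
  obtain ⟨k, t, hk, h⟩ := exists_levels Nat.prime_two (dvd_of_not_vanishesAt Nat.prime_two hn) hcon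
  obtain ⟨a1, a2, a3, a4⟩ := h 0
  obtain ⟨b1, b2, b3, b4⟩ := h 1
  obtain ⟨c1, c2, c3, c4⟩ := h 2
  have h01 : k 0 + 1 ≤ k 1 := hk (by decide)
  have h12 : k 1 + 1 ≤ k 2 := hk (by decide)
  generalize k 0 = k₁ at *
  generalize k 1 = k₂ at *
  generalize k 2 = k₃ at *
  generalize t 0 = t₁ at *
  generalize t 1 = t₂ at *
  generalize t 2 = t₃ at *
  have hne : ¬ ∀ x ∈ A, ∀ y ∈ A, x ≡ y [MOD 2 ^ (k₁ + 1)] := fun hall =>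
    hn _ a1 a2 a3 (a4.of_forall_modEq a2 hall)
  have hthree : ∀ x ∈ A, 3 ≤ dyadicCard A k₂ x := fun x hx =>
    not_two_levels h12 b4 c4 b2 c2 b1 c1 hx
  obtain ⟨x, hx, y, hy, hxy⟩ : ∃ x ∈ A, ∃ y ∈ A, ¬ x ≡ y [MOD 2 ^ k₂] := by
    by_contra! hall
    exact hne fun x hx y hy => (hall x hx y hy).of_dvd (pow_dvd_pow 2 h01)
  obtain ⟨w, hw, q, hq, hwq, hwc, hqc, hcov⟩ := exists_three_four_classes hA hthree hx hy hxy
  set W := A.filter (· ≡ w [MOD 2 ^ k₂]) with hWdef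
  set Q := A.filter (· ≡ q [MOD 2 ^ k₂]) with hQdef
  have hWcard : W.card = 3 := hwc
  have hQcard : Q.card = 4 := hqc
  have hdisj : Disjoint W Q := by
    rw [hWdef, hQdef, Finset.disjoint_filter]
    exact fun a _ h1 h2 => hwq (h1.symm.trans h2)
  have huni : W ∪ Q = A := by
    rw [hWdef, hQdef, ← Finset.filter_or, Finset.filter_true_of_mem hcov]
  -- `W` and `Q` are the two classes at the first level
  have hq1 : 5 ≤ dyadicCard A k₁ q := by
    by_contra! hlt
    have e1 := dyadicCard_anti (A := A) (x := q) h01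
    have e2 := a4.dyadicCard_small a2 a1 hq (by omega)
    omega
  have hwq1 : w ≡ q [MOD 2 ^ k₁] := by
    by_contra hne
    have hsub : A.filter (· ≡ q [MOD 2 ^ k₁]) ⊆ Q := by
      intro a ha
      rw [Finset.mem_filter] at ha
      rcases hcov a ha.1 with h | h
      · exact absurd ((h.of_dvd (pow_dvd_pow 2 (by omega))).symm.trans ha.2) hne
      · exact Finset.mem_filter.2 ⟨ha.1, h⟩
    have := Finset.card_le_card hsub
    simp only [dyadicCard] at hq1
    omega
  have hwq2 : ¬ w ≡ q [MOD 2 ^ (k₁ + 1)] := by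
    intro hwq2
    have : ∀ a ∈ A, a ≡ q [MOD 2 ^ (k₁ + 1)] := fun a ha => by
      rcases hcov a ha with h | h
      · exact (h.of_dvd (pow_dvd_pow 2 h01)).trans hwq2
      · exact h.of_dvd (pow_dvd_pow 2 h01)
    exact hne fun x hx y hy => (this x hx).trans (this y hy).symm
  have hvan : VanishesAt (W ∪ Q) (fun a => if a ∈ W then 1 else -1) t₁ := by
    intro η hη
    rw [← (a4.class_diff Nat.prime_two a2 hwq1) η hη, huni]
    refine Finset.sum_congr rfl fun a ha => ?_
    congr 2
    beta_reduce
    rcases hcov a ha with h | h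
    · have h' := h.of_dvd (pow_dvd_pow 2 h01)
      have haW : a ∈ W := Finset.mem_filter.2 ⟨ha, h⟩
      rw [if_pos haW, if_pos h', if_neg fun h2 => hwq2 (h'.symm.trans h2)]
      rfl
    · have h' := h.of_dvd (pow_dvd_pow 2 h01)
      have haW : a ∉ W := fun haW => hwq ((Finset.mem_filter.1 haW).2.symm.trans h)
      rw [if_neg haW, if_pos h', if_neg fun h2 => hwq2 (h2.symm.trans h')]
      rfl
  -- `W` is a `3`-fiber at the second and third level
  have hW2 : dyadicCard A (k₂ + 1) w = 3 := by
    have := b4.dyadicCard_small b2 b1 hw (by omega)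
    omega
  have hWv2 : VanishesAt W 1 t₂ := b4.class_of_card_eq b2 (by omega)
  have hW3 : dyadicCard A k₃ w = 3 := by
    have e1 := dyadicCard_anti (A := A) (x := w) h12
    have e2 := c4.dyadicCard_small c2 c1 hw (by omega)
    -- If `W` broke up before the third level, the part containing `w` would have two elements and
    -- the rest would be a singleton, which is impossible there.
    by_contra hne
    have hsub : A.filter (· ≡ w [MOD 2 ^ k₃]) ⊆ W := Finset.monotone_filter_right _
      fun _ _ h => Nat.ModEq.of_dvd (pow_dvd_pow 2 (by omega)) h
    obtain ⟨z, hz, hzn⟩ := Finset.exists_of_ssubset (Finset.ssubset_iff_subset_ne.2 ⟨hsub, fun he =>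
      hne (by rw [dyadicCard, he, hWcard])⟩)
    have hzA := (Finset.mem_filter.1 hz).1
    have hsub' : A.filter (· ≡ z [MOD 2 ^ k₃]) ⊆ W := fun a ha => by
      rw [Finset.mem_filter] at ha
      exact Finset.mem_filter.2 ⟨ha.1, (ha.2.of_dvd (pow_dvd_pow 2 (by omega))).trans
        (Finset.mem_filter.1 hz).2⟩
    have hd : Disjoint (A.filter (· ≡ w [MOD 2 ^ k₃])) (A.filter (· ≡ z [MOD 2 ^ k₃])) := by
      rw [Finset.disjoint_filter]
      exact fun a _ h1 h2 => hzn (Finset.mem_filter.2 ⟨hzA, h2.symm.trans h1⟩)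
    have e3 := Finset.card_le_card (Finset.union_subset hsub hsub')
    rw [Finset.card_union_of_disjoint hd, hWcard] at e3
    simp only [dyadicCard] at e2 e3
    have e4 := c4.dyadicCard_small c2 c1 hzA (by simp only [dyadicCard]; omega)
    simp only [dyadicCard] at e4
    omega
  have hWv3 : VanishesAt W 1 t₃ := by
    have e1 := c4.dyadicCard_small c2 c1 hw (by omega)
    have e2 := c4.class_of_card_eq c2 (w := w) (by omega)
    have e3 : A.filter (· ≡ w [MOD 2 ^ k₃]) = W := Finset.eq_of_subset_of_card_le
      (Finset.monotone_filter_right _ fun _ _ h => Nat.ModEq.of_dvd (pow_dvd_pow 2 (by omega)) h)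
      (by rw [hWcard]; exact hW3.ge)
    rwa [e3] at e2
  obtain ⟨c, r, ht2, hr3, hr, hWc, hWd⟩ := hWv2.triadic_fiber hWcard b1 b2
  obtain ⟨c', r', ht3, -, -, hWc', hWd'⟩ := hWv3.triadic_fiber hWcard c1 c2
  obtain rfl : c = c' := le_antisymm (triadic_level_unique hWcard hWc hWd')
    (triadic_level_unique hWcard hWc' hWd)
  subst ht2
  have hQmod := modEq_of_dyadic_splitting (Q := Q) h12 b4 c4 b2 hr3 hr c2 c1
    (ht3 ▸ dvd_mul_right _ _) (fun a ha => ?_) hQcard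
  · exact not_vanishesAt_three_sub_four hdisj hWcard hQcard hWc hWd hQmod a1 a2
      (by rw [hA] at a3; exact a3.symm) hvan
  · rw [hQdef]
    have haq := (Finset.mem_filter.1 ha).2
    exact Finset.filter_congr fun x _ => ⟨fun h => h.trans haq.symm, fun h => h.trans haq⟩

/-- For sets with at most ten elements there is a unitary cover. -/
theorem hasUnitaryCover_of_card_le_ten {A : Finset ℕ} (h2 : 2 ≤ A.card) (h10 : A.card ≤ 10) :
    HasUnitaryCover A := by
  have hone : ∀ p, p.Prime → ¬ p ∣ A.card →
      (∀ l, l.Prime → l.Coprime A.card → l ≠ p → A.card < l) → HasUnitaryCover A := by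
    intro p hp hpA hl
    refine hasUnitaryCover_of_empty h2 fun s hs => hpA ?_
    have := (vanishesAt_of_mem hs).dvd_sum hp (pos_of_mem_accumulatingDivisors hs)
      fun l h1 h2 h3 => hl l h1 ((coprime_card_of_mem hs).coprime_dvd_left h2) h3
    simpa [Int.natCast_dvd_natCast] using this
  -- Since `#A` is not a combination of `p₁` and `p₂`, the set `A` cannot vanish at an order prime
  -- to `q` and `#A`; so `q` divides every accumulating `s`.
  have htwo : ∀ q e, q.Prime → q ^ e < A.card → ∀ p₁ p₂ : ℕ, p₁.Prime → p₂.Prime →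
      (∀ i ≤ 10, ∀ j ≤ 10, A.card ≠ i * p₁ + j * p₂) →
      (∀ l, l.Prime → l.Coprime A.card → l ≠ q → l ≠ p₁ → l ≠ p₂ → A.card < l) →
      ((∀ t, 0 < t → q.Coprime t → t.Coprime A.card → ¬ VanishesAt A 1 t) →
        (accumulatingLevels A q).card ≤ e) → HasUnitaryCover A := by
    intro q e hq hlt p₁ p₂ hp₁ hp₂ hcomb hl hlev
    have hn : ∀ t, 0 < t → q.Coprime t → t.Coprime A.card → ¬ VanishesAt A 1 t := by
      intro t ht hqt htA hv
      obtain ⟨i, j, hij⟩ := hv.card_eq_combination hp₁ hp₂ ht fun l h1 h2 h3 h4 =>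
        hl l h1 (htA.coprime_dvd_left h2) (ne_of_coprime_of_dvd hq hqt h2) h3 h4
      have h5 := hp₁.one_lt
      have h6 := hp₂.one_lt
      exact hcomb i (by nlinarith) j (by nlinarith) hij
    exact hasUnitaryCover_of_prime hq (dvd_of_not_vanishesAt hq hn)
      ((Nat.pow_le_pow_right hq.pos (hlev hn)).trans_lt hlt)
  obtain ⟨N, hN⟩ : ∃ N, A.card = N := ⟨_, rfl⟩
  have hsmall : ∀ l, l.Prime → l ≤ 10 → l = 2 ∨ l = 3 ∨ l = 5 ∨ l = 7 := by
    intro l hl hle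
    interval_cases l <;> first | omega | exact absurd hl (by norm_num)
  have hcop : ∀ l, l.Prime → l.Coprime A.card → ¬ l ∣ A.card := fun l hl h =>
    hl.coprime_iff_not_dvd.1 h
  rw [hN] at h2 h10
  -- For `2, 3, 4, 6` the accumulating set is empty. For `5, 7, 9` the prime is `q = 2` with at most
  -- `2, 2, 3` exponents; for `8` and `10` it is `q = 5` and `q = 7` with at most one.
  interval_cases N
  · refine hone 3 (by norm_num) (by omega) fun l h1 h2 h3 => ?_
    by_contra! hle
    have h4 := hcop l h1 h2
    rcases hsmall l h1 (by omega) with rfl | rfl | rfl | rfl <;> omega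
  · refine hone 2 (by norm_num) (by omega) fun l h1 h2 h3 => ?_
    by_contra! hle
    have h4 := hcop l h1 h2
    rcases hsmall l h1 (by omega) with rfl | rfl | rfl | rfl <;> omega
  · refine hone 3 (by norm_num) (by omega) fun l h1 h2 h3 => ?_
    by_contra! hle
    have h4 := hcop l h1 h2
    rcases hsmall l h1 (by omega) with rfl | rfl | rfl | rfl <;> omega
  · refine htwo 2 2 (by norm_num) (by omega) 3 3 (by norm_num) (by norm_num) (by omega) ?_
      (card_levels_le_two_of_card_five hN)
    intro l h1 h2 h3 h4 h5
    by_contra! hle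
    have h4 := hcop l h1 h2
    rcases hsmall l h1 (by omega) with rfl | rfl | rfl | rfl <;> omega
  · refine hone 5 (by norm_num) (by omega) fun l h1 h2 h3 => ?_
    by_contra! hle
    have h4 := hcop l h1 h2
    rcases hsmall l h1 (by omega) with rfl | rfl | rfl | rfl <;> omega
  · refine htwo 2 2 (by norm_num) (by omega) 3 5 (by norm_num) (by norm_num) (by omega) ?_
      (card_levels_le_two_of_card_seven hN)
    intro l h1 h2 h3 h4 h5
    by_contra! hle
    have h4 := hcop l h1 h2
    rcases hsmall l h1 (by omega) with rfl | rfl | rfl | rfl <;> omega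
  · refine htwo 5 1 (by norm_num) (by omega) 3 7 (by norm_num) (by norm_num) (by omega) ?_
      (card_levels_le_one (by norm_num) (by omega))
    intro l h1 h2 h3 h4 h5
    by_contra! hle
    have h4 := hcop l h1 h2
    rcases hsmall l h1 (by omega) with rfl | rfl | rfl | rfl <;> omega
  · refine htwo 2 3 (by norm_num) (by omega) 5 7 (by norm_num) (by norm_num) (by omega) ?_
      (card_levels_le_three_of_card_nine hN)
    intro l h1 h2 h3 h4 h5
    by_contra! hle
    have h4 := hcop l h1 h2
    rcases hsmall l h1 (by omega) with rfl | rfl | rfl | rfl <;> omega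
  · refine htwo 7 1 (by norm_num) (by omega) 3 3 (by norm_num) (by norm_num) (by omega) ?_
      (card_levels_le_one (by norm_num) (by omega))
    intro l h1 h2 h3 h4 h5
    by_contra! hle
    have h4 := hcop l h1 h2
    rcases hsmall l h1 (by omega) with rfl | rfl | rfl | rfl <;> omega

/-! ### Large sets with constrained differences, and lower bounds away from zeros -/

/-- Averaging over translations of the circle: some translate of the arc `‖y‖ ≤ r / 2` keeps a
proportion `r` of a given set. -/
lemma exists_shift_volume_ge {Γ : Set ℝ} (hΓ : MeasurableSet Γ) (hfin : volume Γ ≠ ⊤) (a : ℝ)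
    {r : ℝ} (hr : r ≤ 1) : ∃ τ : UnitAddCircle, ENNReal.ofReal r * volume Γ ≤
      volume (Γ ∩ {ξ : ℝ | ‖((a * ξ : ℝ) : UnitAddCircle) + τ‖ ≤ r / 2}) := by
  set E : Set (ℝ × UnitAddCircle) := {x | ‖((a * x.1 : ℝ) : UnitAddCircle) + x.2‖ ≤ r / 2} with hE
  have hcont : Continuous fun x : ℝ × UnitAddCircle => ((a * x.1 : ℝ) : UnitAddCircle) + x.2 :=
    ((AddCircle.continuous_mk' (1 : ℝ)).comp (continuous_const.mul continuous_fst)).add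
      continuous_snd
  have hEm : MeasurableSet E := (isClosed_le hcont.norm continuous_const).measurableSet
  -- Fubini on `E`: for fixed `ξ` the slice is an arc of length `r`, and some slice for fixed `τ` is
  -- at least the average.
  have h1 : ((volume.restrict Γ).prod (volume : Measure UnitAddCircle)) E =
      ENNReal.ofReal r * volume Γ := by
    rw [Measure.prod_apply hEm]
    have : ∀ ξ : ℝ, (volume : Measure UnitAddCircle) (Prod.mk ξ ⁻¹' E) = ENNReal.ofReal r := by
      intro ξ
      have hball : Prod.mk ξ ⁻¹' E =
          Metric.closedBall (-((a * ξ : ℝ) : UnitAddCircle)) (r / 2) := by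
        ext τ
        simp only [hE, Set.mem_preimage, Set.mem_ofPred_eq, Metric.mem_closedBall, dist_eq_norm,
          sub_neg_eq_add, add_comm τ]
      rw [hball, AddCircle.volume_closedBall, mul_div_cancel₀ r two_ne_zero, min_eq_right hr]
    simp [this]
  have h2 : ((volume.restrict Γ).prod (volume : Measure UnitAddCircle)) E =
      ∫⁻ τ : UnitAddCircle, volume (Γ ∩ {ξ : ℝ | ‖((a * ξ : ℝ) : UnitAddCircle) + τ‖ ≤ r / 2}) := by
    rw [Measure.prod_apply_symm hEm]
    refine lintegral_congr fun τ => ?_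
    rw [Measure.restrict_apply' hΓ, Set.inter_comm]
    rfl
  have : IsProbabilityMeasure (volume : Measure UnitAddCircle) :=
    ⟨by rw [AddCircle.measure_univ, ENNReal.ofReal_one]⟩
  rw [← h1, h2]
  refine exists_lintegral_le ?_
  rw [← h2, h1]
  exact ENNReal.mul_ne_top ENNReal.ofReal_ne_top hfin

/-- A subset of `[0, 1]` of measure at least `∏ r i` whose difference set satisfies
`‖a i * ξ‖ ≤ r i` on the circle for all `i`. -/
lemma exists_set_norm_sub_le {ι : Type*} (I : Finset ι) (a r : ι → ℝ)
    (hr : ∀ i ∈ I, 0 ≤ r i ∧ r i ≤ 1) :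
    ∃ Γ : Set ℝ, MeasurableSet Γ ∧ Γ ⊆ Set.Icc 0 1 ∧
      ENNReal.ofReal (∏ i ∈ I, r i) ≤ volume Γ ∧
      ∀ ξ ∈ Γ, ∀ ξ' ∈ Γ, ∀ i ∈ I, ‖((a i * (ξ - ξ') : ℝ) : UnitAddCircle)‖ ≤ r i := by
  classical
  induction I using Finset.induction_on with
  | empty => exact ⟨Set.Icc 0 1, measurableSet_Icc, le_rfl, by simp, by simp⟩
  | insert j I hj ih =>
    obtain ⟨Γ, h1, h2, h3, h4⟩ := ih fun i hi => hr i (Finset.mem_insert_of_mem hi)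
    obtain ⟨hj0, hj1⟩ := hr j (Finset.mem_insert_self j I)
    have hfin : volume Γ ≠ ⊤ := ne_top_of_le_ne_top (by simp) (measure_mono h2)
    obtain ⟨τ, hτ⟩ := exists_shift_volume_ge h1 hfin (a j) hj1
    have hcont : Continuous fun ξ : ℝ => ((a j * ξ : ℝ) : UnitAddCircle) + τ :=
      ((AddCircle.continuous_mk' (1 : ℝ)).comp (continuous_const.mul continuous_id)).add
        continuous_const
    -- Radius `r j / 2` around a common centre gives `r j` for differences; the translation `τ`
    -- cancels.
    refine ⟨Γ ∩ {ξ : ℝ | ‖((a j * ξ : ℝ) : UnitAddCircle) + τ‖ ≤ r j / 2},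
      h1.inter (isClosed_le hcont.norm continuous_const).measurableSet,
      Set.inter_subset_left.trans h2, ?_, ?_⟩
    · refine le_trans ?_ hτ
      rw [Finset.prod_insert hj, ENNReal.ofReal_mul hj0]
      gcongr
    · intro ξ hξ ξ' hξ' i hi
      rcases Finset.mem_insert.1 hi with rfl | hi
      · have e : ((a i * (ξ - ξ') : ℝ) : UnitAddCircle) =
            (((a i * ξ : ℝ) : UnitAddCircle) + τ) - (((a i * ξ' : ℝ) : UnitAddCircle) + τ) := by
          rw [add_sub_add_right_eq_sub, mul_sub]; rfl
        rw [e]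
        refine (norm_sub_le _ _).trans ?_
        have e1 : ‖((a i * ξ : ℝ) : UnitAddCircle) + τ‖ ≤ r i / 2 := hξ.2
        have e2 : ‖((a i * ξ' : ℝ) : UnitAddCircle) + τ‖ ≤ r i / 2 := hξ'.2
        linarith
      · exact h4 ξ hξ.1 ξ' hξ'.1 i hi

lemma phiAcc_add_int (A : Finset ℕ) (ξ : ℝ) (j : ℤ) : phiAcc A (ξ + j) = phiAcc A ξ := by
  have : Complex.exp (2 * Real.pi * Complex.I * ((ξ + j : ℝ) : ℂ)) =
      Complex.exp (2 * Real.pi * Complex.I * ξ) := by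
    push_cast
    rw [mul_add, Complex.exp_add, mul_comm _ (j : ℂ), Complex.exp_int_mul_two_pi_mul_I, mul_one]
  rw [phiAcc, phiAcc, this]

lemma continuous_phiAcc (A : Finset ℕ) : Continuous (phiAcc A) := by
  unfold phiAcc
  exact (Polynomial.continuous_aeval _).comp (Complex.continuous_exp.comp
    (continuous_const.mul Complex.continuous_ofReal))

lemma exists_isPrimitiveRoot_of_phiAcc_eq_zero {A : Finset ℕ} {ξ : ℝ} (h : phiAcc A ξ = 0) :
    ∃ s ∈ accumulatingDivisors A,
      IsPrimitiveRoot (Complex.exp (2 * Real.pi * Complex.I * ξ)) s := by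
  rw [phiAcc, accumulatingFactor, map_prod, Finset.prod_eq_zero_iff] at h
  obtain ⟨s, hs, h0⟩ := h
  refine ⟨s, hs, ?_⟩
  have : NeZero (s : ℂ) := ⟨Nat.cast_ne_zero.2 (pos_of_mem_accumulatingDivisors hs).ne'⟩
  rw [aeval_def, ← eval_map, algebraMap_int_eq, map_cyclotomic] at h0
  exact isRoot_cyclotomic_iff.1 h0

/-- For a prime power `u = p ^ (k + 1)`, the frequency `p ^ k * M'` with `M'` the part of
`∏ s` prime to `p`. -/
noncomputable def unitaryFrequency (A : Finset ℕ) (u : ℕ) : ℕ :=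
  u / u.minFac * ordCompl[u.minFac] (∏ s ∈ accumulatingDivisors A, s)

/-- With `D` the frequency, `s` divides `p * D` while `p ^ (k + 1)` does not divide `D`. At a
primitive `s`-th root `D ξ` is thus a non-integer multiple of `1 / p`, at distance at least `1 / p >
ρ / p` from the integers. -/
lemma not_isPrimitiveRoot_of_norm_le {A : Finset ℕ} {s t p k : ℕ} {ξ ρ : ℝ} (hp : p.Prime)
    (hs : s ∈ accumulatingDivisors A) (hst : s = p ^ (k + 1) * t) (hpt : p.Coprime t) (hρ : ρ < 1)
    (hξ : ‖((unitaryFrequency A (p ^ (k + 1)) * ξ : ℝ) : UnitAddCircle)‖ ≤ ρ / p) :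
    ¬ IsPrimitiveRoot (Complex.exp (2 * Real.pi * Complex.I * ξ)) s := by
  intro hprim
  set M := ∏ s ∈ accumulatingDivisors A, s with hM
  have hM0 : M ≠ 0 := Finset.prod_ne_zero_iff.2 fun s hs => (pos_of_mem_accumulatingDivisors hs).ne'
  set M' := ordCompl[p] M with hM'
  have hpM : p.Coprime M' := Nat.coprime_ordCompl hp hM0
  have hD : unitaryFrequency A (p ^ (k + 1)) = p ^ k * M' := by
    rw [unitaryFrequency, hp.pow_minFac (Nat.succ_ne_zero k), pow_succ,
      Nat.mul_div_cancel _ hp.pos]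
  rw [hD] at hξ
  have htM : t ∣ M' := by
    have h1 : t ∣ ordProj[p] M * M' := by
      rw [hM', Nat.ordProj_mul_ordCompl_eq_self]
      exact (Dvd.intro_left _ hst.symm).trans (Finset.dvd_prod_of_mem _ hs)
    exact (Nat.Coprime.pow_left _ hpt).symm.dvd_of_dvd_mul_left h1
  have hpow : ∀ j : ℕ, Complex.exp (2 * Real.pi * Complex.I * ξ) ^ j = 1 ↔
      ∃ n : ℤ, (j : ℝ) * ξ = n := by
    intro j
    rw [← Complex.exp_nat_mul, Complex.exp_eq_one_iff]
    refine exists_congr fun n => ?_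
    have hpi : (2 * Real.pi * Complex.I : ℂ) ≠ 0 := Complex.two_pi_I_ne_zero
    constructor
    · intro h
      have : ((j : ℝ) * ξ : ℂ) = (n : ℂ) := by
        apply mul_right_cancel₀ hpi
        rw [← h]; push_cast; ring
      exact_mod_cast this
    · intro h
      have : ((j : ℝ) * ξ : ℂ) = (n : ℂ) := by exact_mod_cast congrArg (fun x : ℝ => (x : ℂ)) h
      rw [← this]; push_cast; ring
  have hnot : ¬ ∃ n : ℤ, ((p ^ k * M' : ℕ) : ℝ) * ξ = n := by
    rw [← hpow, hprim.pow_eq_one_iff_dvd, hst]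
    intro hd
    have h1 : p ^ k * p ∣ p ^ k * M' := by
      rw [← pow_succ]; exact (dvd_mul_right _ _).trans hd
    exact hp.coprime_iff_not_dvd.1 hpM (Nat.dvd_of_mul_dvd_mul_left (pow_pos hp.pos k) h1)
  obtain ⟨n, hn⟩ : ∃ n : ℤ, ((p * (p ^ k * M') : ℕ) : ℝ) * ξ = n := by
    rw [← hpow, hprim.pow_eq_one_iff_dvd, hst, ← mul_assoc, ← pow_succ']
    exact Nat.mul_dvd_mul_left _ htM
  refine hnot ⟨round (((p ^ k * M' : ℕ) : ℝ) * ξ), ?_⟩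
  rw [UnitAddCircle.norm_eq] at hξ
  set x : ℝ := ((p ^ k * M' : ℕ) : ℝ) * ξ with hx
  have hp0 : (0 : ℝ) < p := Nat.cast_pos.2 hp.pos
  have hpx : (p : ℝ) * (x - round x) = ((n - p * round x : ℤ) : ℝ) := by
    rw [mul_sub, hx, ← mul_assoc, ← Nat.cast_mul, hn]; push_cast; ring
  have hlt : |(p : ℝ) * (x - round x)| < 1 := by
    rw [abs_mul, abs_of_pos hp0]
    rw [le_div_iff₀ hp0] at hξ
    linarith
  rw [hpx, ← Int.cast_abs] at hlt
  have h0 : n - p * round x = 0 := Int.abs_lt_one_iff.1 (by exact_mod_cast hlt)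
  rw [h0, Int.cast_zero, mul_eq_zero] at hpx
  exact sub_eq_zero.1 (hpx.resolve_left hp0.ne')

/-- The cover rules out every zero under the constraints. These are closed and, the frequencies
being integers, `1`-periodic, so a minimum over a compact part of `[0, 1]` suffices. -/
lemma exists_phiAcc_lower_bound {A Q : Finset ℕ} (hQ : ∀ u ∈ Q, ∃ p k, p.Prime ∧ u = p ^ (k + 1))
    (hcov : ∀ s ∈ accumulatingDivisors A, ∃ u ∈ Q, ∃ t, s = u * t ∧ u.Coprime t)
    {ρ : ℝ} (hρ : ρ < 1) :
    ∃ c > 0, ∀ ξ : ℝ, (∀ u ∈ Q,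
      ‖((unitaryFrequency A u * ξ : ℝ) : UnitAddCircle)‖ ≤ ρ / u.minFac) → c ≤ ‖phiAcc A ξ‖ := by
  set K : Set ℝ := Set.Icc 0 1 ∩ ⋂ u ∈ Q,
    {ξ | ‖((unitaryFrequency A u * ξ : ℝ) : UnitAddCircle)‖ ≤ ρ / u.minFac} with hK
  have hKc : IsCompact K := by
    refine isCompact_Icc.inter_right (isClosed_biInter fun u _ => ?_)
    exact isClosed_le ((AddCircle.continuous_mk' (1 : ℝ)).comp
      (continuous_const.mul continuous_id)).norm continuous_const
  have hne : ∀ ξ ∈ K, phiAcc A ξ ≠ 0 := by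
    intro ξ hξ h0
    obtain ⟨s, hs, hprim⟩ := exists_isPrimitiveRoot_of_phiAcc_eq_zero h0
    obtain ⟨u, hu, t, hst, hut⟩ := hcov s hs
    obtain ⟨p, k, hp, rfl⟩ := hQ u hu
    have h1 := Set.mem_iInter₂.1 hξ.2 _ hu
    rw [Set.mem_ofPred_eq, hp.pow_minFac (Nat.succ_ne_zero k)] at h1
    exact not_isPrimitiveRoot_of_norm_le hp hs hst
      (Nat.Coprime.coprime_dvd_left (dvd_pow_self p (Nat.succ_ne_zero k)) hut) hρ h1 hprim
  have hred : ∀ ξ : ℝ, (∀ u ∈ Q,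
      ‖((unitaryFrequency A u * ξ : ℝ) : UnitAddCircle)‖ ≤ ρ / u.minFac) →
      Int.fract ξ ∈ K ∧ phiAcc A (Int.fract ξ) = phiAcc A ξ := by
    intro ξ hξ
    refine ⟨⟨⟨Int.fract_nonneg ξ, (Int.fract_lt_one ξ).le⟩, Set.mem_iInter₂.2 fun u hu => ?_⟩, ?_⟩
    · have e : ((unitaryFrequency A u * Int.fract ξ : ℝ) : UnitAddCircle) =
          ((unitaryFrequency A u * ξ : ℝ) : UnitAddCircle) := by
        rw [← sub_eq_zero, ← AddCircle.coe_sub, AddCircle.coe_eq_zero_iff]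
        refine ⟨-(unitaryFrequency A u * ⌊ξ⌋), ?_⟩
        rw [← Int.self_sub_floor]
        simp only [zsmul_eq_mul, mul_one]
        push_cast
        ring
      rw [Set.mem_ofPred_eq, e]
      exact hξ u hu
    · conv_rhs => rw [← Int.fract_add_floor ξ, phiAcc_add_int]
  rcases K.eq_empty_or_nonempty with hemp | hKn
  · refine ⟨1, one_pos, fun ξ hξ => ?_⟩
    have := (hred ξ hξ).1
    rw [hemp] at this
    exact absurd this (Set.notMem_empty _)
  · obtain ⟨x, hx, hmin⟩ := hKc.exists_isMinOn hKn (continuous_phiAcc A).norm.continuousOn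
    refine ⟨‖phiAcc A x‖, norm_pos_iff.2 (hne x hx), fun ξ hξ => ?_⟩
    rw [← (hred ξ hξ).2]
    exact hmin (hred ξ hξ).1

/-! ### Choice of constants and conclusion -/

lemma exists_pow_mul_gt {W L : ℝ} (R : ℕ) (h : W < L) :
    ∃ ρ : ℝ, 0 < ρ ∧ ρ < 1 ∧ W < ρ ^ R * L := by
  have hc : Filter.Tendsto (fun ρ : ℝ => ρ ^ R * L) (nhdsWithin 1 (Set.Iio 1)) (nhds (1 ^ R * L)) :=
    ((continuous_pow R).mul continuous_const).continuousAt.tendsto.mono_left nhdsWithin_le_nhds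
  rw [one_pow, one_mul] at hc
  have h0 : ∀ᶠ ρ : ℝ in nhdsWithin 1 (Set.Iio 1), 0 < ρ :=
    nhdsWithin_le_nhds (lt_mem_nhds one_pos)
  obtain ⟨ρ, h1, h2, h3⟩ := (h0.and ((hc.eventually (lt_mem_nhds h)).and
    self_mem_nhdsWithin)).exists
  exact ⟨ρ, h1, h3, h2⟩

lemma exists_rpow_lt {L δ : ℝ} (hL : 1 < L) (h : 1 / L < δ) :
    ∃ η : ℝ, 0 < η ∧ η < 1 ∧ L ^ (-(1 - η)) < δ := by
  have hL0 : 0 < L := one_pos.trans hL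
  have hc : Filter.Tendsto (fun η : ℝ => L ^ (-(1 - η))) (nhdsWithin 0 (Set.Ioi 0))
      (nhds (L ^ (-(1 - 0) : ℝ))) := by
    have : Continuous fun η : ℝ => L ^ (-(1 - η)) :=
      Continuous.rpow continuous_const (by fun_prop) fun _ => Or.inl hL0.ne'
    exact this.continuousAt.tendsto.mono_left nhdsWithin_le_nhds
  rw [sub_zero, Real.rpow_neg_one, ← one_div] at hc
  have h1 : ∀ᶠ η : ℝ in nhdsWithin 0 (Set.Ioi 0), η < 1 :=
    nhdsWithin_le_nhds (gt_mem_nhds one_pos)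
  obtain ⟨η, h1, h2, h3⟩ := (h1.and ((hc.eventually (gt_mem_nhds h)).and
    self_mem_nhdsWithin)).exists
  exact ⟨η, h3, h1, h2⟩

lemma exists_rpow_neg_le {L c : ℝ} (hL : 1 < L) (hc : 0 < c) :
    ∃ C : ℝ, 0 < C ∧ L ^ (-C) ≤ c := by
  have hL0 : 0 < L := one_pos.trans hL
  obtain ⟨n, hn⟩ := exists_pow_lt_of_lt_one hc (inv_lt_one_of_one_lt₀ hL)
  refine ⟨n + 1, by positivity, le_trans ?_ hn.le⟩
  rw [← Real.rpow_natCast, Real.inv_rpow hL0.le, ← Real.rpow_neg hL0.le]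
  exact Real.rpow_le_rpow_of_exponent_le hL.le (by linarith)

lemma phiAccProd_eq_prod {n : ℕ} (A : Fin (n + 1) → Finset ℕ) (t : Fin n → ℝ) (ξ : ℝ) :
    phiAccProd A t ξ =
      ∏ i, phiAcc (A i) ((Fin.cons 1 t : Fin (n + 1) → ℝ) i * ξ) := by
  rw [phiAccProd, Fin.prod_univ_succ]
  simp

/-- Unitary covers make `φ_t''` SLV-structured, uniformly in `t`. -/
theorem isSLVStructuredWith_of_hasUnitaryCover {n L : ℕ} {A : Fin (n + 1) → Finset ℕ}
    (hcard : ∀ i, 2 ≤ (A i).card) (hL : ∏ i, (A i).card ≤ L) (hA : ∀ i, HasUnitaryCover (A i)) :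
    ∃ C₁ C₂ η : ℝ, ∀ t : Fin n → ℝ, IsSLVStructuredWith L (phiAccProd A t) C₁ C₂ η 0 := by
  choose Q hQ hcov hlt using hA
  have hmin : ∀ i, ∀ u ∈ Q i, 2 ≤ u.minFac := by
    intro i u hu
    obtain ⟨p, k, hp, rfl⟩ := hQ i u hu
    rw [hp.pow_minFac (Nat.succ_ne_zero k)]
    exact hp.two_le
  have hWL : ∏ i, ∏ u ∈ Q i, u.minFac < L := by
    refine lt_of_lt_of_le (Finset.prod_lt_prod_of_nonempty (fun i _ => ?_) (fun i _ => hlt i)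
      Finset.univ_nonempty) hL
    exact Finset.prod_pos fun u hu => two_pos.trans_le (hmin i u hu)
  have hL1 : (1 : ℝ) < L := by
    have h1 : 2 ^ (n + 1) ≤ ∏ i, (A i).card := by
      simpa using Finset.prod_le_prod' (s := Finset.univ) (f := fun _ => 2) fun i _ => hcard i
    have h2 : 1 < 2 ^ (n + 1) := Nat.one_lt_two_pow (Nat.succ_ne_zero n)
    exact_mod_cast (by omega : 1 < L)
  have hL0 : (0 : ℝ) < L := one_pos.trans hL1
  have hW0 : 0 < ∏ i, ∏ u ∈ Q i, (u.minFac : ℝ) :=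
    Finset.prod_pos fun i _ => Finset.prod_pos fun u hu =>
      Nat.cast_pos.2 (two_pos.trans_le (hmin i u hu))
  -- The strict inequality between the product of the primes and `L` leaves room for `ρ < 1`, and
  -- then for `η > 0`.
  obtain ⟨ρ, hρ0, hρ1, hρ⟩ := exists_pow_mul_gt (∑ i, (Q i).card)
    (show (∏ i, ∏ u ∈ Q i, (u.minFac : ℝ)) < L by exact_mod_cast hWL)
  set δ : ℝ := ∏ i, ∏ u ∈ Q i, (ρ / u.minFac) with hδ
  have hδeq : δ = ρ ^ (∑ i, (Q i).card) / ∏ i, ∏ u ∈ Q i, (u.minFac : ℝ) := by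
    simp only [hδ, Finset.prod_div_distrib, Finset.prod_const, Finset.prod_pow_eq_pow_sum]
  have hδL : 1 / (L : ℝ) < δ := by
    rw [hδeq, div_lt_div_iff₀ hL0 hW0]
    linarith
  obtain ⟨η, hη0, hη1, hη⟩ := exists_rpow_lt hL1 hδL
  choose c hc0 hc using fun i => exists_phiAcc_lower_bound (hQ i) (hcov i) hρ1
  obtain ⟨C, hC0, hC⟩ := exists_rpow_neg_le hL1 (Finset.prod_pos fun i (_ : i ∈ Finset.univ) => hc0 i)
  refine ⟨C, 1, η, fun t => ⟨hC0, one_pos, hη0, hη1, fun m _ => ?_⟩⟩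
  set T : Fin (n + 1) → ℝ := Fin.cons 1 t with hT
  -- One constraint for each scale, set and cover element; the parameter `t` enters only through the
  -- dilations.
  obtain ⟨Γ, hΓm, hΓI, hΓv, hΓd⟩ := exists_set_norm_sub_le
    ((Finset.range m) ×ˢ (Finset.univ.sigma Q))
    (fun x => unitaryFrequency (A x.2.1) x.2.2 * (T x.2.1 * (L : ℝ) ^ x.1))
    (fun x => ρ / x.2.2.minFac) (fun x hx => by
      have h2 := hmin _ _ (Finset.mem_sigma.1 (Finset.mem_product.1 hx).2).2
      have h2' : (2 : ℝ) ≤ (x.2.2.minFac : ℝ) := by exact_mod_cast h2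
      refine ⟨by positivity, ?_⟩
      rw [div_le_one (by linarith)]
      linarith)
  refine ⟨Γ, hΓm, hΓI, ?_, ?_⟩
  · rintro _ ⟨ξ, hξ, ξ', hξ', rfl⟩
    show (L : ℝ) ^ (-(C * m)) ≤ _
    have hfac : ∀ k ∈ Finset.range m,
        ∏ i, c i ≤ ‖phiAccProd A t ((L : ℝ) ^ k * (ξ - ξ'))‖ := by
      intro k hk
      rw [phiAccProd_eq_prod, norm_prod]
      refine Finset.prod_le_prod (fun i _ => (hc0 i).le) fun i _ => hc i _ fun u hu => ?_
      have := hΓd ξ hξ ξ' hξ' (k, ⟨i, u⟩)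
        (Finset.mem_product.2 ⟨hk, Finset.mem_sigma.2 ⟨Finset.mem_univ i, hu⟩⟩)
      simpa only [mul_assoc] using this
    calc (L : ℝ) ^ (-(C * m)) = ((L : ℝ) ^ (-C)) ^ m := by
          rw [← Real.rpow_natCast, ← Real.rpow_mul hL0.le, neg_mul]
      _ ≤ (∏ i, c i) ^ m := pow_le_pow_left₀ (by positivity) hC m
      _ = ∏ k ∈ Finset.range m, ∏ i, c i := by rw [Finset.prod_const, Finset.card_range]
      _ ≤ _ := by
          rw [norm_prod]
          exact Finset.prod_le_prod (fun k _ => Finset.prod_nonneg fun i _ => (hc0 i).le) hfac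
  · rw [hausdorffMeasure_real]
    refine le_trans (ENNReal.ofReal_le_ofReal ?_) hΓv
    rw [Finset.prod_product]
    simp only [Finset.prod_const, Finset.card_range, Finset.prod_sigma, one_mul]
    calc (L : ℝ) ^ (-((1 - η) * m)) = ((L : ℝ) ^ (-(1 - η))) ^ m := by
          rw [← Real.rpow_natCast, ← Real.rpow_mul hL0.le, neg_mul]
      _ ≤ δ ^ m := pow_le_pow_left₀ (by positivity) hη.le m

theorem proposition3p4 (n L : ℕ) (hn : 1 ≤ n) (A : Fin (n + 1) → Finset ℕ)
    (hcard : ∀ i, 2 ≤ (A i).card) (hL : ∏ i, (A i).card ≤ L)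
    (hA : ∀ i, (A i).card ≤ 10 ∨
      ((accumulatingDivisors (A i)).lcm id).primeFactors.card ≤ 2 ∨
      AdmitsFiberedSubset (A i)) :
    ∃ (C₁ C₂ η : ℝ) (m₀ : ℕ), ∀ t : Fin n → ℝ, (∀ i, t i ∈ Set.Icc (0 : ℝ) 1) →
      IsSLVStructuredWith L (phiAccProd A t) C₁ C₂ η m₀ := by
  obtain ⟨C₁, C₂, η, h⟩ := isSLVStructuredWith_of_hasUnitaryCover hcard hL fun i => by
    rcases hA i with h | h | h
    · exact hasUnitaryCover_of_card_le_ten (hcard i) h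
    · exact hasUnitaryCover_of_two_primes (hcard i) h
    · exact hasUnitaryCover_of_admitsFiberedSubset (hcard i) h
  exact ⟨C₁, C₂, η, 0, fun t _ => h t⟩
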